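/- **Setting.** Let $\mathcal X$ be a finite set, let $1\le n_0\le n$ and $k\ge1$ be integers, and let $\beta'\in(0,1)$. A growing dataset $\vec X=(X_1,\dots,X_n)$ consists of i.i.d. points from a distribution $\mathcal P$ on $\mathcal X$. A statistical query is a function $q:\mathcal X\to[0,1]$; its value on the snapshot $\vec x_{[t]}=(x_1,\dots,x_t)$ is $q(\vec x_{[t]})=\frac1t\sum_{\tau\le t}q(x_\tau)$, and $q(\mathcal P^t)=\mathbb E_{\vec X\sim\mathcal P^t}[q(\vec X)]$. In each round $t=n_0,\dots,n$ a randomized analyst, who sees only the transcript of past rounds, queries and responses, adaptively decides which statistical queries to ask and when to finish the round; the number of queries per round is thus chosen adaptively. The mechanism $\mathsf M_{\sigma,\rho}$ is the clipped Gaussian mechanism with constant noise level $\sigma>0$ tracked by a zCDP privacy filter with target level $\rho\ge 0$. It keeps a running privacy level $\bar\rho$, initially $0$. When a query $q$ is asked in round $t$, it sets $\bar\rho\leftarrow\bar\rho+\frac1{2\sigma^2t^2}$. If then $\bar\rho\le\rho$, it returns $r=\max(0,\min(q(\vec X_{[t]})+z,1))$ with fresh noise $z\sim\mathcal N(0,\sigma^2)$;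 otherwise it terminates the interaction. Say that $\mathsf M_{\sigma,\rho}$ is $(\alpha,\beta)$-*distributionally accurate for $k$ statistical queries* if for every distribution $\mathcal P$ on $\mathcal X$ and every analyst, with probability at least $1-\beta$ over the dataset, the analyst and the noise, each of the first $k$ responses released, $r$ to a query $q$ in a round $t$, satisfies $|r-q(\mathcal P^t)|\le\alpha$. (If the mechanism answers $k$ queries without terminating, these are all $k$ responses; if fewer than $k$ are released, the condition concerns those that are.) For $\rho\ge0$ and $\epsilon\ge0$ put $$\delta(\rho,\epsilon)=\inf_{\gamma\in(1,\infty)}\frac{e^{(\gamma-1)(\gamma\rho-\epsilon)}(1-\gamma^{-1})^{\gamma}}{\gamma-1},$$ let $\Theta=\{(\sigma,\beta,\epsilon)\in\mathbb R^3:\sigma>0,\ 0<\beta<1,\ \epsilon\ge0\}$, let $\operatorname{erfc}^{-1}$ be the inverse of the complementary error function, and put $$\lambda_\rho(\sigma,\beta,\epsilon)=\sqrt2\,\sigma\operatorname{erfc}^{-1}\!\Big(\frac\beta k\Big)+e^\epsilon-1+\frac{2n\,\delta(\rho,\epsilon)}{n_0\beta'}+\frac\beta{\beta'}+\frac2{\beta'}\sqrt{\frac{2\beta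 n\,\delta(\rho,\epsilon)}{n_0}}.$$ **Theorem.** Let the target level $\rho(\sigma)\ge0$ be chosen as any function (for instance a constant) of the noise level $\sigma>0$. 1. For every $\sigma>0$, the mechanism $\mathsf M_{\sigma,\rho(\sigma)}$ is $(\alpha',\beta')$-distributionally accurate for $k$ statistical queries with $\alpha'=\inf_{0<\beta<1,\ \epsilon\ge0}\lambda_{\rho(\sigma)}(\sigma,\beta,\epsilon)$. 2. Consequently, if $(\sigma^\star,\beta^\star,\epsilon^\star)$ minimizes $\lambda_{\rho(\sigma)}(\sigma,\beta,\epsilon)$ over $\Theta$, then the mechanism run with noise level $\sigma^\star$, $\mathsf M_{\sigma^\star,\rho(\sigma^\star)}$, is $(\alpha',\beta')$-distributionally accurate for $k$ statistical queries with $\alpha'=\min_{(\sigma,\beta,\epsilon)\in\Theta}\lambda_{\rho(\sigma)}(\sigma,\beta,\epsilon)$. -/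

import Mathlib

open MeasureTheory ProbabilityTheory

universe u v

noncomputable section

namespace GrowingADA

/-- A statistical query on the data domain `X`, given by its per-point function `X → [0, 1]`. -/
abbrev StatQuery (X : Type*) := X → unitInterval

/-- The value of a statistical query on a snapshot `y` of size `t`: the empirical average. -/
def snapshotValue {X : Type*} {t : ℕ} (q : StatQuery X) (y : Fin t → X) : ℝ :=
  (∑ τ, (q (y τ) : ℝ)) / t

/-- The value `q(P^t)` of a statistical query on the data distribution: the expected value of the
query on a snapshot of `t` i.i.d. points with law `P`. -/
def populationValue {X : Type*} [MeasurableSpace X] (P : Measure X) (t : ℕ) (q : StatQuery X) : ℝ :=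
  ∫ y : Fin t → X, snapshotValue q y ∂(Measure.pi fun _ : Fin t => P)

/-- One entry of a transcript: the round, the query asked in it, and the response. -/
abbrev Entry (X : Type*) := ℕ × StatQuery X × ℝ

/-- A randomised adaptive analyst. Its internal randomness is a seed in `Ω`. In round `t`, having
seen a transcript with `m` entries, it decides whether it is finished with the round, and if not
which query to ask next. It never sees the data. -/
structure Analyst (X Ω : Type*) [MeasurableSpace Ω] where
  finished : (t m : ℕ) → Ω × (Fin m → Entry X) → Bool
  query : (t m : ℕ) → Ω × (Fin m → Entry X) → StatQuery X
  measurable_finished : ∀ t m, Measurable (finished t m)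
  measurable_query : ∀ t m, Measurable (query t m)

/-- The state of the interaction: the transcript so far, the current round, the running privacy
level of the filter, and whether the filter has terminated the interaction. -/
structure State (X : Type*) where
  size : ℕ
  transcript : Fin size → Entry X
  round : ℕ
  spent : ℝ
  terminated : Bool

/-- Clamping to the unit interval. -/
def clamp (x : ℝ) : ℝ := max 0 (min x 1)

/-- The zCDP cost `1 / (2 σ_t² t²)` of a statistical query in round `t`. -/
def cost (sigma : ℕ → ℝ) (t : ℕ) : ℝ := 1 / (2 * sigma t ^ 2 * (t : ℝ) ^ 2)

/-- The state at the start: round `n₀`, empty transcript, nothing spent. -/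
def initState (X : Type*) (n₀ : ℕ) : State X := ⟨0, Fin.elim0, n₀, 0, false⟩

/-- One step of the interaction between the analyst `A` with seed `ω` and the clipped Gaussian
mechanism with round-dependent noise levels `sigma`, tracked by a zCDP privacy filter with target
level `ρ`, on the growing dataset `x`. The noise for the answer with index `m` is
`sigma t * z m`, with `z` a sequence of standard Gaussians. -/
def step {X Ω : Type*} [MeasurableSpace Ω] {n : ℕ} (sigma : ℕ → ℝ) (ρ : ℝ) (A : Analyst X Ω)
    (x : Fin n → X) (ω : Ω) (z : ℕ → ℝ) (s : State X) : State X :=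
  if s.terminated then s
  else if h : s.round ≤ n then
    if A.finished s.round s.size (ω, s.transcript) then { s with round := s.round + 1 }
    else if s.spent + cost sigma s.round ≤ ρ then
      let q := A.query s.round s.size (ω, s.transcript)
      let r := clamp (snapshotValue q (fun τ : Fin s.round => x (Fin.castLE h τ))
        + sigma s.round * z s.size)
      { size := s.size + 1
        transcript := Fin.snoc (α := fun _ => Entry X) s.transcript (s.round, q, r)
        round := s.round
        spent := s.spent + cost sigma s.round
        terminated := false }
    else { s with terminated := true }
  else s

/-- The state after `N` steps. -/
def stateAfter {X Ω : Type*} [MeasurableSpace Ω] {n : ℕ} (n₀ : ℕ) (sigma : ℕ → ℝ) (ρ : ℝ)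
    (A : Analyst X Ω) (x : Fin n → X) (ω : Ω) (z : ℕ → ℝ) (N : ℕ) : State X :=
  (step sigma ρ A x ω z)^[N] (initState X n₀)

/-- The joint law of the dataset (`n` i.i.d. points), the seed of the analyst, and the i.i.d.
standard Gaussian noise of the mechanism. -/
def jointLaw {X Ω : Type*} [MeasurableSpace X] [MeasurableSpace Ω] (n : ℕ) (P : Measure X)
    (μ : Measure Ω) : Measure ((Fin n → X) × Ω × (ℕ → ℝ)) :=
  (Measure.pi fun _ : Fin n => P).prod
    (μ.prod (Measure.infinitePi fun _ : ℕ => gaussianReal 0 1))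

/-- `(α, β)`-distributional accuracy for `k` statistical queries, on the data domain `X`, of the
clipped Gaussian mechanism with zCDP filter: for every data distribution and every analyst, the
probability that one of the first `k` released answers has distributional error more than `α` is
at most `β`. If the mechanism answers `k` queries without terminating, these are all `k` answers;
otherwise they are those released before the interaction ends. -/
def IsDistributionallyAccurate (X : Type u) [MeasurableSpace X] (n₀ n k : ℕ)
    (sigma : ℕ → ℝ) (ρ α β : ℝ) : Prop :=
  ∀ (P : Measure X) [IsProbabilityMeasure P]
    (Ω : Type v) [MeasurableSpace Ω] (μ : Measure Ω) [IsProbabilityMeasure μ] (A : Analyst X Ω),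
    jointLaw n P μ
      {w | ∃ N, ∃ i : Fin (stateAfter n₀ sigma ρ A w.1 w.2.1 w.2.2 N).size, (i : ℕ) < k ∧
        α < |((stateAfter n₀ sigma ρ A w.1 w.2.1 w.2.2 N).transcript i).2.2 -
          populationValue P
            ((stateAfter n₀ sigma ρ A w.1 w.2.1 w.2.2 N).transcript i).1
            ((stateAfter n₀ sigma ρ A w.1 w.2.1 w.2.2 N).transcript i).2.1|}
      ≤ ENNReal.ofReal β

/-- The complementary error function. -/
def erfc (x : ℝ) : ℝ := 2 / Real.sqrt Real.pi * ∫ u in Set.Ioi x, Real.exp (-u ^ 2)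

/-- The inverse of `erfc`, a bijection from `ℝ` to `(0, 2)`. -/
def erfcInv : ℝ → ℝ := Function.invFun erfc

/-- The `δ` for which `ρ`-zCDP is converted to `(ε, δ)`-differential privacy. -/
def deltaOf (ρ ε : ℝ) : ℝ :=
  ⨅ γ : Set.Ioi (1 : ℝ), Real.exp (((γ : ℝ) - 1) * (γ * ρ - ε)) *
    (1 - (γ : ℝ)⁻¹) ^ (γ : ℝ) / ((γ : ℝ) - 1)

/-- The error bound as a function of the noise level `σ` and the free parameters `β` and `ε`. -/
def errorBound (n₀ n k : ℕ) (ρ β' σ β ε : ℝ) : ℝ :=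
  Real.sqrt 2 * σ * erfcInv (β / k) + Real.exp ε - 1
    + 2 * n * deltaOf ρ ε / (n₀ * β') + β / β'
    + 2 / β' * Real.sqrt (2 * β * n * deltaOf ρ ε / n₀)

/-- The parameter set `Θ` of triples `(σ, β, ε)`. -/
def paramSet : Set (ℝ × ℝ × ℝ) := {θ | 0 < θ.1 ∧ 0 < θ.2.1 ∧ θ.2.1 < 1 ∧ 0 ≤ θ.2.2}

end GrowingADA

end

noncomputable section

namespace GrowingADA

open scoped ENNReal

/-! ### Resampling one coordinate of a product measure, Gaussian change of measure, and `erfc`. -/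

section Preliminaries

/-! The error of an answer splits into its noise and the gap between the empirical value of the
query and its mean under `P`. Outside an event of probability at most `β`, a Gaussian tail bound and
a union bound keep the first `k` noise terms below `√2 σ erfcInv (β / k)`, and clipping does not
increase the error. The gap is small because a query selected by a private computation cannot
overfit.

Privacy (`flatExp_le`, `flatExp_le_deltaOf`): changing one data point shifts an answer of round `t`
by at most `1 / t` before clipping, so its noise acquires a log-normal likelihood ratio whose `γ`-th
moment is at most `exp (γ (γ - 1) cost)`. An induction on steps carries the ratio accumulated so
far; as the filter bounds the total cost by `ρ` on every path, the adaptive choice of costs does no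
harm. A tangent-line inequality turns the moment into `(ε, δ)`.

Transfer (`lintegral_selected_le`): the value of a selected query is a sum of contributions of
single points, each at most `1 / n₀`. Exchanging a point for a fresh copy costs a factor `exp ε` and
a term `δ / n₀`; summed over the points, the expected empirical value is at most `exp ε` times the
expected mean, plus `n δ / n₀`.

Accuracy (`measureReal_selected_le`, `measure_exists_errs_le`): the first wrong answer is a function
of the state, hence privately selected. The transfer bound, applied to its query when the answer is
too high and to the complementary query when it is too low, bounds the probability of each case.
Adding the two cases gives `β'`. -/

theorem measurable_update_pair {ι Y : Type*} [DecidableEq ι] [MeasurableSpace Y] (m : ι) :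
    Measurable (fun p : (ι → Y) × Y => Function.update p.1 m p.2) := by
  refine measurable_pi_lambda _ fun i => ?_
  by_cases h : i = m
  · subst h; simpa using measurable_snd
  · simp only [Function.update_of_ne h]; fun_prop

/-- Replacing one coordinate of a product-distributed family by an independent copy preserves the
product measure. -/
theorem measurePreserving_update_infinitePi {ι Y : Type*} [DecidableEq ι] [MeasurableSpace Y]
    (γ : Measure Y) [IsProbabilityMeasure γ] (m : ι) :
    MeasurePreserving (fun p : (ι → Y) × Y => Function.update p.1 m p.2)
      ((Measure.infinitePi fun _ : ι => γ).prod γ) (Measure.infinitePi fun _ : ι => γ) := by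
  have hmeas := measurable_update_pair (Y := Y) m
  refine ⟨hmeas, Measure.eq_infinitePi _ fun s t ht => ?_⟩
  rw [Measure.map_apply hmeas (MeasurableSet.pi s.countable_toSet fun i _ => ht i)]
  by_cases hm : m ∈ s
  · have : (fun p : (ι → Y) × Y => Function.update p.1 m p.2) ⁻¹' (Set.pi s t)
        = (Set.pi (s.erase m) t) ×ˢ (t m) := by
      ext ⟨z, y⟩
      simp only [Set.mem_preimage, Set.mem_pi, Set.mem_prod, Finset.coe_erase, Set.mem_sdiff,
        Finset.mem_coe, Set.mem_singleton_iff]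
      constructor
      · intro h
        refine ⟨fun i hi => ?_, by simpa using h m hm⟩
        simpa [Function.update_of_ne hi.2] using h i hi.1
      · rintro ⟨h1, h2⟩ i hi
        by_cases h : i = m
        · subst h; simpa using h2
        · simpa [Function.update_of_ne h] using h1 i ⟨hi, h⟩
    rw [this, Measure.prod_prod, Measure.infinitePi_pi _
      (fun i _ => ht i), Finset.prod_erase_mul _ _ hm]
  · have : (fun p : (ι → Y) × Y => Function.update p.1 m p.2) ⁻¹' (Set.pi s t)
        = (Set.pi s t) ×ˢ Set.univ := by
      ext ⟨z, y⟩
      simp only [Set.mem_preimage, Set.mem_pi, Set.mem_prod, Finset.mem_coe, Set.mem_univ, and_true]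
      refine forall₂_congr fun i hi => ?_
      rw [Function.update_of_ne (fun h : i = m => hm (h ▸ hi))]
    rw [this, Measure.prod_prod, Measure.infinitePi_pi _ (fun i _ => ht i)]
    simp

theorem lintegral_infinitePi_update {ι Y : Type*} [DecidableEq ι] [MeasurableSpace Y]
    (γ : Measure Y) [IsProbabilityMeasure γ] (m : ι) {g : (ι → Y) → ℝ≥0∞} (hg : Measurable g) :
    ∫⁻ z, g z ∂(Measure.infinitePi fun _ : ι => γ)
      = ∫⁻ z, ∫⁻ y, g (Function.update z m y) ∂γ ∂(Measure.infinitePi fun _ : ι => γ) := by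
  rw [← (measurePreserving_update_infinitePi γ m).lintegral_comp hg, lintegral_prod]
  exact (hg.comp (measurable_update_pair m)).aemeasurable

/-- Swapping one coordinate of a product-distributed family with an independent copy. -/
theorem lintegral_pi_update_swap {ι Y : Type*} [DecidableEq ι] [Fintype ι] [MeasurableSpace Y]
    (γ : Measure Y) [IsProbabilityMeasure γ] (m : ι) {g : (ι → Y) × Y → ℝ≥0∞}
    (hg : Measurable g) :
    ∫⁻ x, ∫⁻ y, g (Function.update x m y, x m) ∂γ ∂(Measure.pi fun _ : ι => γ)
      = ∫⁻ x, ∫⁻ y, g (x, y) ∂γ ∂(Measure.pi fun _ : ι => γ) := by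
  rw [← Measure.infinitePi_eq_pi]
  set μ := Measure.infinitePi fun _ : ι => γ
  have hup := measurable_update_pair (Y := Y) m
  have h1 : Measurable fun x : ι → Y => ∫⁻ y, g (Function.update x m y, x m) ∂γ := by
    refine Measurable.lintegral_prod_right' (f := fun p : (ι → Y) × Y =>
      g (Function.update p.1 m p.2, p.1 m)) ?_
    exact hg.comp (hup.prodMk (by fun_prop))
  -- Resampling coordinate `m` once more gives the old value a name of its own; the two independent
  -- variables can then be exchanged.
  rw [lintegral_infinitePi_update γ m h1]
  simp only [Function.update_idem, Function.update_self]
  rw [lintegral_lintegral_swap, lintegral_lintegral_swap (f := fun x y => g (x, y))]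
  · refine lintegral_congr fun v => ?_
    exact (lintegral_infinitePi_update γ m (g := fun x => g (x, v)) (by fun_prop)).symm
  · exact hg.aemeasurable
  · refine (Measurable.lintegral_prod_right' (f := fun p : ((ι → Y) × Y) × Y =>
      g (Function.update p.1.1 m p.2, p.1.2)) ?_).aemeasurable
    exact hg.comp ((hup.comp (by fun_prop : Measurable fun p : ((ι → Y) × Y) × Y =>
      (p.1.1, p.2))).prodMk (by fun_prop))

/-- Translating a standard Gaussian amounts to a change of density. -/
theorem lintegral_gaussianReal_add (c : ℝ) {g : ℝ → ℝ≥0∞} (hg : Measurable g) :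
    ∫⁻ y, g (y + c) ∂gaussianReal 0 1
      = ∫⁻ y, ENNReal.ofReal (Real.exp (c * y - c ^ 2 / 2)) * g y ∂gaussianReal 0 1 := by
  have h := gaussianReal_map_add_const (μ := 0) (v := 1) c
  rw [← lintegral_map (f := g) (g := fun y => y + c) hg (by fun_prop), h,
    gaussianReal_of_var_ne_zero _ one_ne_zero, gaussianReal_of_var_ne_zero _ one_ne_zero,
    lintegral_withDensity_eq_lintegral_mul _ (measurable_gaussianPDF _ _) hg,
    lintegral_withDensity_eq_lintegral_mul _ (measurable_gaussianPDF _ _) (by fun_prop)]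
  refine lintegral_congr fun y => ?_
  simp only [Pi.mul_apply, gaussianPDF, ← mul_assoc]
  rw [← ENNReal.ofReal_mul (gaussianPDFReal_nonneg _ _ _)]
  congr 2
  simp only [gaussianPDFReal, NNReal.coe_one, mul_assoc, ← Real.exp_add]
  congr 3
  ring

theorem lintegral_gaussianReal_exp_rpow (c γ : ℝ) :
    ∫⁻ y, ENNReal.ofReal (Real.exp (c * y - c ^ 2 / 2) ^ γ) ∂gaussianReal 0 1
      = ENNReal.ofReal (Real.exp (γ * (γ - 1) * (c ^ 2 / 2))) := by
  have h := lintegral_gaussianReal_add (γ * c) (g := fun _ => 1) measurable_const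
  simp only [lintegral_const, measure_univ, mul_one] at h
  -- The `γ`-th power of the density for shift `c` is a constant times the density for shift `γ *
  -- c`, which integrates to one.
  calc _ = ∫⁻ y, ENNReal.ofReal (Real.exp (γ * (γ - 1) * (c ^ 2 / 2))) *
        ENNReal.ofReal (Real.exp (γ * c * y - (γ * c) ^ 2 / 2)) ∂gaussianReal 0 1 := by
        refine lintegral_congr fun y => ?_
        rw [← ENNReal.ofReal_mul (Real.exp_nonneg _), ← Real.exp_add, ← Real.exp_mul]
        congr 2
        ring
    _ = _ := by rw [lintegral_const_mul _ (by fun_prop), ← h, mul_one]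

/-- The tangent-line inequality behind the conversion of Rényi divergence bounds to approximate
differential privacy. -/
theorem le_exp_add_rpow {a ε γ : ℝ} (ha : 0 ≤ a) (hγ : 1 < γ) :
    a ≤ Real.exp ε + Real.exp (-((γ - 1) * ε)) * (1 - γ⁻¹) ^ γ / (γ - 1) * a ^ γ := by
  have hγ0 : 0 < γ := by linarith
  have hγ1 : 0 < γ - 1 := by linarith
  have hinv : 0 ≤ 1 - γ⁻¹ := by
    have := inv_le_one_of_one_le₀ hγ.le
    linarith
  set b := a * Real.exp (-ε) with hb
  have hb0 : 0 ≤ b := by positivity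
  -- Bernoulli's inequality is the tangent to `b ^ γ` at `b = γ / (γ - 1)`, the point where this
  -- tangent is a multiple of `b - 1`.
  have hB := one_add_mul_self_le_rpow_one_add (s := (1 - γ⁻¹) * b - 1) (p := γ)
    (by nlinarith [mul_nonneg hinv hb0]) hγ.le
  rw [show 1 + ((1 - γ⁻¹) * b - 1) = (1 - γ⁻¹) * b by ring, Real.mul_rpow hinv hb0] at hB
  have h2 : 1 + γ * ((1 - γ⁻¹) * b - 1) = (γ - 1) * (b - 1) := by field_simp; ring
  rw [h2] at hB
  have hbγ : b ^ γ * Real.exp ε = a ^ γ * Real.exp (-((γ - 1) * ε)) := by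
    rw [hb, Real.mul_rpow ha (Real.exp_nonneg _), ← Real.exp_mul, mul_assoc, ← Real.exp_add]
    congr 2; ring
  have hab : a = b * Real.exp ε := by
    rw [hb, mul_assoc, ← Real.exp_add]; simp
  have h3 : b - 1 ≤ (1 - γ⁻¹) ^ γ * b ^ γ / (γ - 1) := by
    rw [le_div_iff₀ hγ1]; linarith
  calc a = Real.exp ε + (b - 1) * Real.exp ε := by rw [hab]; ring
    _ ≤ Real.exp ε + (1 - γ⁻¹) ^ γ * b ^ γ / (γ - 1) * Real.exp ε := by gcongr
    _ = _ := by
      rw [show (1 - γ⁻¹) ^ γ * b ^ γ / (γ - 1) * Real.exp ε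
        = (1 - γ⁻¹) ^ γ / (γ - 1) * (b ^ γ * Real.exp ε) by ring, hbγ]
      ring

/-! ### The complementary error function and Gaussian tails. -/

theorem integrable_exp_neg_sq : Integrable fun u : ℝ => Real.exp (-u ^ 2) := by
  simpa using integrable_exp_neg_mul_sq one_pos

theorem integral_exp_neg_sq_Ioi_zero :
    ∫ u in Set.Ioi (0 : ℝ), Real.exp (-u ^ 2) = Real.sqrt Real.pi / 2 := by
  simpa using integral_gaussian_Ioi 1

theorem erfc_zero : erfc 0 = 1 := by
  rw [erfc, integral_exp_neg_sq_Ioi_zero]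
  field_simp

theorem erfc_antitone : Antitone erfc := by
  intro x y h
  unfold erfc
  gcongr
  · exact Filter.Eventually.of_forall fun u => Real.exp_nonneg _
  · exact integrable_exp_neg_sq.integrableOn

theorem erfc_eq_sub (x : ℝ) :
    erfc x = 1 - 2 / Real.sqrt Real.pi * ∫ u in (0 : ℝ)..x, Real.exp (-u ^ 2) := by
  have h := intervalIntegral.integral_Ioi_sub_Ioi' (f := fun u : ℝ => Real.exp (-u ^ 2)) (a := 0)
    (b := x) integrable_exp_neg_sq.integrableOn integrable_exp_neg_sq.integrableOn
  rw [← h, mul_sub, ← erfc_zero]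
  simp only [erfc]
  ring

theorem continuous_erfc : Continuous erfc := by
  rw [funext erfc_eq_sub]
  exact continuous_const.sub (continuous_const.mul
    (intervalIntegral.continuous_primitive (fun _ _ => integrable_exp_neg_sq.intervalIntegrable) 0))

theorem tendsto_erfc_atTop : Filter.Tendsto erfc Filter.atTop (nhds 0) := by
  have h := (intervalIntegral_tendsto_integral_Ioi (f := fun u : ℝ => Real.exp (-u ^ 2)) 0
    integrable_exp_neg_sq.integrableOn Filter.tendsto_id)
  rw [integral_exp_neg_sq_Ioi_zero] at h
  have h2 := (h.const_mul (2 / Real.sqrt Real.pi)).const_sub 1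
  rw [show 1 - 2 / Real.sqrt Real.pi * (Real.sqrt Real.pi / 2) = 0 by field_simp; ring] at h2
  rw [funext erfc_eq_sub]
  exact h2

/-- `Function.invFun` is a right inverse on the range, so the intermediate value theorem is enough.
-/
theorem erfc_erfcInv {b : ℝ} (h0 : 0 < b) (h1 : b < 1) : erfc (erfcInv b) = b := by
  obtain ⟨M, hM⟩ := (tendsto_erfc_atTop.eventually (gt_mem_nhds h0)).exists
  have := mem_range_of_exists_le_of_exists_ge continuous_erfc ⟨M, hM.le⟩
    ⟨0, by rw [erfc_zero]; exact h1.le⟩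
  exact Function.invFun_eq this

theorem erfcInv_nonneg {b : ℝ} (h0 : 0 < b) (h1 : b < 1) : 0 ≤ erfcInv b := by
  by_contra! h
  have := erfc_antitone h.le
  rw [erfc_erfcInv h0 h1, erfc_zero] at this
  linarith

theorem gaussianReal_Ioi (u : ℝ) :
    gaussianReal 0 1 (Set.Ioi (Real.sqrt 2 * u)) = ENNReal.ofReal (erfc u / 2) := by
  rw [gaussianReal_apply_eq_integral _ one_ne_zero]
  congr 1
  have h := integral_comp_mul_left_Ioi (fun y => gaussianPDFReal 0 1 y) u
    (b := Real.sqrt 2) (by positivity)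
  have h2 : ∫ y in Set.Ioi (Real.sqrt 2 * u), gaussianPDFReal 0 1 y
      = Real.sqrt 2 * ∫ y in Set.Ioi u, gaussianPDFReal 0 1 (Real.sqrt 2 * y) := by
    rw [h, smul_eq_mul, ← mul_assoc, mul_inv_cancel₀ (by positivity), one_mul]
  rw [h2, erfc, ← integral_const_mul, ← integral_const_mul, ← integral_div]
  congr 1
  ext y
  simp only [gaussianPDFReal, NNReal.coe_one, mul_one, sub_zero, mul_pow, Nat.ofNat_nonneg,
    Real.sq_sqrt]
  rw [Real.sqrt_mul (by norm_num)]
  field_simp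

theorem gaussianReal_abs_gt_le (u : ℝ) :
    gaussianReal 0 1 {y | Real.sqrt 2 * u < |y|} ≤ ENNReal.ofReal (erfc u) := by
  have hneg : gaussianReal 0 1 ((fun y => -y) ⁻¹' Set.Ioi (Real.sqrt 2 * u))
      = gaussianReal 0 1 (Set.Ioi (Real.sqrt 2 * u)) := by
    rw [← Measure.map_apply (by fun_prop) measurableSet_Ioi, gaussianReal_map_neg, neg_zero]
  have herfc : 0 ≤ erfc u := by
    unfold erfc
    exact mul_nonneg (by positivity) (integral_nonneg fun _ => Real.exp_nonneg _)
  calc _ ≤ gaussianReal 0 1 (Set.Ioi (Real.sqrt 2 * u) ∪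
        (fun y => -y) ⁻¹' Set.Ioi (Real.sqrt 2 * u)) := by
        refine measure_mono fun y hy => ?_
        simpa [lt_abs, lt_neg] using hy
    _ ≤ _ := measure_union_le _ _
    _ = ENNReal.ofReal (erfc u) := by
        rw [hneg, gaussianReal_Ioi, ← ENNReal.ofReal_add (by positivity) (by positivity)]
        congr 1; ring

end Preliminaries

/-! ### The interaction on states with a fixed type of transcript, and its measurability. -/

section Flat

/-- A state of the interaction whose transcript is stored as an infinite sequence, of which only
the first `size` entries are meaningful. -/
@[ext] structure FlatState (X : Type*) where
  size : ℕ
  entry : ℕ → Entry X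
  round : ℕ
  spent : ℝ
  terminated : Bool

namespace FlatState

variable {X W : Type*} [MeasurableSpace W]

/-- The product σ-algebra of the five fields; the sequence `entry` avoids a transcript type that
depends on `size`. -/
instance : MeasurableSpace (FlatState X) :=
  MeasurableSpace.comap (fun s => (s.size, s.entry, s.round, s.spent, s.terminated)) inferInstance

theorem measurable_fields :
    Measurable fun s : FlatState X => (s.size, s.entry, s.round, s.spent, s.terminated) :=
  comap_measurable _

@[fun_prop] theorem measurable_size : Measurable (FlatState.size (X := X)) :=
  measurable_fields.fst

@[fun_prop] theorem measurable_entry : Measurable (FlatState.entry (X := X)) :=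
  measurable_fields.snd.fst

@[fun_prop] theorem measurable_round : Measurable (FlatState.round (X := X)) :=
  measurable_fields.snd.snd.fst

@[fun_prop] theorem measurable_spent : Measurable (FlatState.spent (X := X)) :=
  measurable_fields.snd.snd.snd.fst

@[fun_prop] theorem measurable_terminated : Measurable (FlatState.terminated (X := X)) :=
  measurable_fields.snd.snd.snd.snd

@[fun_prop] theorem measurable_mk {a : W → ℕ} {b : W → ℕ → Entry X} {c : W → ℕ} {d : W → ℝ}
    {e : W → Bool} (ha : Measurable a) (hb : Measurable b) (hc : Measurable c) (hd : Measurable d)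
    (he : Measurable e) :
    Measurable fun w => (⟨a w, b w, c w, d w, e w⟩ : FlatState X) :=
  measurable_comap_iff.2 (ha.prodMk (hb.prodMk (hc.prodMk (hd.prodMk he))))

end FlatState

variable {X Ω : Type*} [MeasurableSpace Ω] {n : ℕ}

/-- The empirical average of a query over the first `t` points of a dataset of size `n`. -/
def prefixValue (q : StatQuery X) (t : ℕ) (x : Fin n → X) : ℝ :=
  (∑ τ : Fin n, if (τ : ℕ) < t then (q (x τ) : ℝ) else 0) / t

theorem snapshotValue_castLE {t : ℕ} (h : t ≤ n) (q : StatQuery X) (x : Fin n → X) :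
    snapshotValue q (fun τ : Fin t => x (Fin.castLE h τ)) = prefixValue q t x := by
  unfold snapshotValue prefixValue
  congr 1
  rw [← Finset.sum_filter]
  refine Finset.sum_bij (fun τ _ => Fin.castLE h τ) (by simp) ?_ ?_ (by simp)
  · intro a _ b _ hab
    simpa [Fin.ext_iff] using hab
  · intro b hb
    exact ⟨⟨b, by simpa using hb⟩, Finset.mem_univ _, rfl⟩

/-- Whether the next step releases an answer. -/
def Answers (n : ℕ) (sigma : ℕ → ℝ) (ρ : ℝ) (A : Analyst X Ω) (ω : Ω) (s : FlatState X) : Prop :=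
  s.terminated = false ∧ s.round ≤ n ∧
    A.finished s.round s.size (ω, fun i : Fin s.size => s.entry i) = false ∧
    s.spent + cost sigma s.round ≤ ρ

/-- The successor of a state in which no answer is released. -/
def idle (n : ℕ) (A : Analyst X Ω) (ω : Ω) (s : FlatState X) : FlatState X :=
  if s.terminated = true then s
  else if s.round ≤ n then
    if A.finished s.round s.size (ω, fun i : Fin s.size => s.entry i) = true then
      ⟨s.size, s.entry, s.round + 1, s.spent, s.terminated⟩
    else ⟨s.size, s.entry, s.round, s.spent, true⟩
  else s

/-- The query that the analyst asks next. -/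
def nextQuery (A : Analyst X Ω) (ω : Ω) (s : FlatState X) : StatQuery X :=
  A.query s.round s.size (ω, fun i : Fin s.size => s.entry i)

/-- The successor of a state in which an answer is released with standardised noise `y`. -/
def answer (sigma : ℕ → ℝ) (A : Analyst X Ω) (x : Fin n → X) (ω : Ω) (y : ℝ) (s : FlatState X) :
    FlatState X :=
  ⟨s.size + 1,
    Function.update s.entry s.size (s.round, nextQuery A ω s,
      clamp (prefixValue (nextQuery A ω s) s.round x + sigma s.round * y)),
    s.round, s.spent + cost sigma s.round, s.terminated⟩

open Classical in
/-- One step of the interaction, on flat states. -/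
def flatStep (sigma : ℕ → ℝ) (ρ : ℝ) (A : Analyst X Ω) (x : Fin n → X) (ω : Ω) (z : ℕ → ℝ)
    (s : FlatState X) : FlatState X :=
  if Answers n sigma ρ A ω s then answer sigma A x ω (z s.size) s else idle n A ω s

/-- The flat state that encodes a state. -/
def flatten (s : State X) : FlatState X :=
  ⟨s.size, fun i => if h : i < s.size then s.transcript ⟨i, h⟩ else (0, fun _ => 0, 0),
    s.round, s.spent, s.terminated⟩

theorem flatten_entry (s : State X) (i : Fin s.size) : (flatten s).entry i = s.transcript i := by
  simp [flatten]

/-- Appending with `Fin.snoc` becomes an update at index `size`, so the two interactions are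
semiconjugate and all probability can be done on flat states. -/
theorem flatten_step (sigma : ℕ → ℝ) (ρ : ℝ) (A : Analyst X Ω) (x : Fin n → X) (ω : Ω)
    (z : ℕ → ℝ) (s : State X) :
    flatten (step sigma ρ A x ω z s) = flatStep sigma ρ A x ω z (flatten s) := by
  have htr : (fun i : Fin s.size => (flatten s).entry i) = s.transcript :=
    funext (flatten_entry s)
  have hfin : A.finished (flatten s).round (flatten s).size
      (ω, fun i : Fin (flatten s).size => (flatten s).entry i)
      = A.finished s.round s.size (ω, s.transcript) := by
    change A.finished s.round s.size (ω, fun i : Fin s.size => (flatten s).entry i) = _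
    rw [htr]
  have hq : nextQuery A ω (flatten s) = A.query s.round s.size (ω, s.transcript) := by
    change A.query s.round s.size (ω, fun i : Fin s.size => (flatten s).entry i) = _
    rw [htr]
  have h1 : (flatten s).terminated = s.terminated := rfl
  have h2 : (flatten s).round = s.round := rfl
  have h3 : (flatten s).spent = s.spent := rfl
  unfold step flatStep Answers idle
  rw [hfin, h1, h2, h3]
  by_cases ht : s.terminated = true
  · simp [ht]
  have htf : s.terminated = false := by simpa using ht
  by_cases hr : s.round ≤ n
  swap
  · simp [ht, hr]
  by_cases hf : A.finished s.round s.size (ω, s.transcript) = true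
  · simp only [htf, hr, hf, Bool.false_eq_true, Bool.true_eq_false, if_false, dif_pos, if_true,
      and_false, false_and]
    exact FlatState.ext rfl rfl rfl rfl rfl
  by_cases hc : s.spent + cost sigma s.round ≤ ρ
  swap
  · simp only [htf, hr, hf, hc, Bool.false_eq_true, if_false, dif_pos, if_true, and_false]
    exact FlatState.ext rfl rfl rfl rfl rfl
  have hff : A.finished s.round s.size (ω, s.transcript) = false := by simpa using hf
  simp only [htf, hr, hff, hc, Bool.false_eq_true, if_false, dif_pos, if_true, and_self]
  unfold answer
  rw [hq, snapshotValue_castLE]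
  refine FlatState.ext rfl ?_ rfl rfl htf.symm
  ext1 i
  change (if h : i < s.size + 1 then _ else _) = Function.update (flatten s).entry s.size _ i
  rcases lt_trichotomy i s.size with h | h | h
  · rw [dif_pos (by omega), Function.update_of_ne h.ne]
    have : (⟨i, by omega⟩ : Fin (s.size + 1)) = Fin.castSucc ⟨i, h⟩ := rfl
    rw [this]
    refine (Fin.snoc_castSucc (α := fun _ => Entry X) _ _ _).trans ?_
    simp [flatten, h]
  · subst h
    rw [dif_pos (by omega), Function.update_self]
    have : (⟨s.size, by omega⟩ : Fin (s.size + 1)) = Fin.last _ := rfl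
    rw [this]
    exact Fin.snoc_last (α := fun _ => Entry X) _ _
  -- Beyond the new entry both sides hold the default entry.
  · rw [dif_neg (by omega), Function.update_of_ne h.ne']
    simp [flatten, h.le]

/-- The flat state after `N` steps from `s`. -/
def flatRun (sigma : ℕ → ℝ) (ρ : ℝ) (A : Analyst X Ω) (x : Fin n → X) (ω : Ω) (z : ℕ → ℝ)
    (N : ℕ) (s : FlatState X) : FlatState X :=
  (flatStep sigma ρ A x ω z)^[N] s

theorem flatRun_succ (sigma : ℕ → ℝ) (ρ : ℝ) (A : Analyst X Ω) (x : Fin n → X) (ω : Ω)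
    (z : ℕ → ℝ) (N : ℕ) (s : FlatState X) :
    flatRun sigma ρ A x ω z (N + 1) s
      = flatRun sigma ρ A x ω z N (flatStep sigma ρ A x ω z s) := rfl

theorem flatten_stateAfter (n₀ : ℕ) (sigma : ℕ → ℝ) (ρ : ℝ) (A : Analyst X Ω) (x : Fin n → X)
    (ω : Ω) (z : ℕ → ℝ) (N : ℕ) :
    flatten (stateAfter n₀ sigma ρ A x ω z N)
      = flatRun sigma ρ A x ω z N (flatten (initState X n₀)) :=
  (Function.Semiconj.iterate_right (f := flatten)
    (fun s => flatten_step sigma ρ A x ω z s) N).eq _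

section Measurability

/-- The type of the analyst's input depends on the size, but round and size take countably many
values, so it suffices to fix them. -/
theorem measurable_analyst_eval {Y : Type*} [MeasurableSpace Y]
    {g : (t m : ℕ) → Ω × (Fin m → Entry X) → Y} (hg : ∀ t m, Measurable (g t m)) :
    Measurable fun p : Ω × FlatState X =>
      g p.2.round p.2.size (p.1, fun i : Fin p.2.size => p.2.entry i) := by
  have h : Measurable fun p : (ℕ × ℕ) × Ω × (ℕ → Entry X) =>
      g p.1.1 p.1.2 (p.2.1, fun i : Fin p.1.2 => p.2.2 i) := by
    refine measurable_from_prod_countable_right fun tm => ?_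
    exact (hg tm.1 tm.2).comp ((by fun_prop : Measurable fun p : Ω × (ℕ → Entry X) => p.1).prodMk
      (measurable_pi_lambda _ fun i => (measurable_pi_apply (i : ℕ)).comp measurable_snd))
  exact h.comp (by fun_prop : Measurable fun p : Ω × FlatState X =>
    ((p.2.round, p.2.size), p.1, p.2.entry))

theorem measurable_clamp : Measurable clamp :=
  measurable_const.max (measurable_id.min measurable_const)

theorem measurable_comp_nat {W Y : Type*} [MeasurableSpace W] [MeasurableSpace Y]
    {f : W → ℕ → Y} {m : W → ℕ} (hf : Measurable f) (hm : Measurable m) :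
    Measurable fun w => f w (m w) := by
  have h : Measurable fun p : ℕ × (ℕ → Y) => p.2 p.1 :=
    measurable_from_prod_countable_right fun i => measurable_pi_apply i
  exact h.comp (hm.prodMk hf)

theorem measurable_update_nat {W Y : Type*} [MeasurableSpace W] [MeasurableSpace Y]
    {f : W → ℕ → Y} {m : W → ℕ} {y : W → Y} (hf : Measurable f) (hm : Measurable m)
    (hy : Measurable y) : Measurable fun w => Function.update (f w) (m w) (y w) := by
  have h : Measurable fun p : ℕ × (ℕ → Y) × Y => Function.update p.2.1 p.1 p.2.2 :=
    measurable_from_prod_countable_right fun i => measurable_update_pair i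
  exact h.comp (hm.prodMk (hf.prodMk hy))

theorem measurable_prefixValue (x : Fin n → X) :
    Measurable fun p : ℕ × StatQuery X => prefixValue p.2 p.1 x := by
  refine measurable_from_prod_countable_right fun t => ?_
  unfold prefixValue
  have (τ : Fin n) : Measurable fun q : StatQuery X => if (τ : ℕ) < t then (q (x τ) : ℝ) else 0 := by
    split_ifs <;> fun_prop
  exact (Finset.measurable_sum Finset.univ fun τ _ => this τ).div_const (t : ℝ)

theorem measurable_cost (sigma : ℕ → ℝ) : Measurable (cost sigma) := measurable_from_nat

theorem measurableSet_answers (n : ℕ) (sigma : ℕ → ℝ) (ρ : ℝ) (A : Analyst X Ω) :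
    MeasurableSet {p : Ω × FlatState X | Answers n sigma ρ A p.1 p.2} := by
  have hc := measurable_cost sigma
  have hf := measurable_analyst_eval A.measurable_finished
  refine MeasurableSet.inter ?_ (MeasurableSet.inter ?_ (MeasurableSet.inter ?_ ?_))
  · exact (by fun_prop : Measurable fun p : Ω × FlatState X => p.2.terminated)
      (measurableSet_singleton false)
  · exact (by fun_prop : Measurable fun p : Ω × FlatState X => p.2.round) measurableSet_Iic
  · exact hf (measurableSet_singleton false)
  · exact measurableSet_le (f := fun p : Ω × FlatState X => p.2.spent + cost sigma p.2.round)
      (by fun_prop) measurable_const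

theorem measurable_idle (n : ℕ) (A : Analyst X Ω) :
    Measurable fun p : Ω × FlatState X => idle n A p.1 p.2 := by
  have hf := measurable_analyst_eval A.measurable_finished
  refine Measurable.ite ?_ (by fun_prop) (Measurable.ite ?_ (Measurable.ite ?_ ?_ ?_)
    (by fun_prop))
  · exact (by fun_prop : Measurable fun p : Ω × FlatState X => p.2.terminated)
      (measurableSet_singleton true)
  · exact (by fun_prop : Measurable fun p : Ω × FlatState X => p.2.round) measurableSet_Iic
  · exact hf (measurableSet_singleton true)
  · fun_prop
  · fun_prop

theorem measurable_nextQuery (A : Analyst X Ω) :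
    Measurable fun p : Ω × FlatState X => nextQuery A p.1 p.2 :=
  measurable_analyst_eval A.measurable_query

theorem measurable_answer (sigma : ℕ → ℝ) (A : Analyst X Ω) (x : Fin n → X) :
    Measurable fun p : Ω × ℝ × FlatState X => answer sigma A x p.1 p.2.1 p.2.2 := by
  have hq : Measurable fun p : Ω × ℝ × FlatState X => nextQuery A p.1 p.2.2 :=
    (measurable_nextQuery A).comp (by fun_prop : Measurable fun p : Ω × ℝ × FlatState X =>
      (p.1, p.2.2))
  have hv : Measurable fun p : Ω × ℝ × FlatState X =>
      prefixValue (nextQuery A p.1 p.2.2) p.2.2.round x :=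
    (measurable_prefixValue x).comp ((by fun_prop : Measurable fun p : Ω × ℝ × FlatState X =>
      p.2.2.round).prodMk hq)
  have hs : Measurable sigma := measurable_from_nat
  have hc := measurable_cost sigma
  have hcl := measurable_clamp
  refine FlatState.measurable_mk (by fun_prop) (measurable_update_nat (by fun_prop) (by fun_prop)
    ?_) (by fun_prop) (by fun_prop) (by fun_prop)
  exact Measurable.prodMk (by fun_prop) (hq.prodMk (hcl.comp (hv.add (by fun_prop))))

theorem measurable_flatStep (sigma : ℕ → ℝ) (ρ : ℝ) (A : Analyst X Ω) (x : Fin n → X) :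
    Measurable fun p : Ω × (ℕ → ℝ) × FlatState X => flatStep sigma ρ A x p.1 p.2.1 p.2.2 := by
  have h2 : Measurable fun p : Ω × (ℕ → ℝ) × FlatState X => (p.1, p.2.2) := by fun_prop
  refine Measurable.ite (h2 (measurableSet_answers n sigma ρ A)) ?_ ((measurable_idle n A).comp h2)
  have h3 := measurable_comp_nat (f := fun p : Ω × (ℕ → ℝ) × FlatState X => p.2.1)
    (m := fun p => p.2.2.size) (by fun_prop) (by fun_prop)
  exact (measurable_answer sigma A x).comp (by fun_prop :
    Measurable fun p : Ω × (ℕ → ℝ) × FlatState X => (p.1, p.2.1 p.2.2.size, p.2.2))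

theorem measurable_flatRun (sigma : ℕ → ℝ) (ρ : ℝ) (A : Analyst X Ω) (x : Fin n → X) (N : ℕ) :
    Measurable fun p : Ω × (ℕ → ℝ) × FlatState X => flatRun sigma ρ A x p.1 p.2.1 N p.2.2 := by
  induction N with
  | zero => exact (by fun_prop : Measurable fun p : Ω × (ℕ → ℝ) × FlatState X => p.2.2)
  | succ N ih =>
    have h := measurable_flatStep sigma ρ A x
    exact ih.comp (by fun_prop : Measurable fun p : Ω × (ℕ → ℝ) × FlatState X =>
      (p.1, p.2.1, flatStep sigma ρ A x p.1 p.2.1 p.2.2))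

end Measurability

end Flat

/-! ### Differential privacy of the interaction under the zCDP filter. -/

section Privacy

variable {X Ω : Type*} [MeasurableSpace Ω] {n : ℕ}

/-- The law of the standardised noise. -/
abbrev noise : Measure (ℕ → ℝ) := Measure.infinitePi fun _ : ℕ => gaussianReal 0 1

theorem flatStep_of_answers {sigma : ℕ → ℝ} {ρ : ℝ} {A : Analyst X Ω} {ω : Ω} {s : FlatState X}
    (h : Answers n sigma ρ A ω s) (x : Fin n → X) (z : ℕ → ℝ) :
    flatStep sigma ρ A x ω z s = answer sigma A x ω (z s.size) s := if_pos h

theorem flatStep_of_not_answers {sigma : ℕ → ℝ} {ρ : ℝ} {A : Analyst X Ω} {ω : Ω}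
    {s : FlatState X} (h : ¬ Answers n sigma ρ A ω s) (x : Fin n → X) (z : ℕ → ℝ) :
    flatStep sigma ρ A x ω z s = idle n A ω s := if_neg h

theorem idle_size (A : Analyst X Ω) (ω : Ω) (s : FlatState X) : (idle n A ω s).size = s.size := by
  unfold idle; split_ifs <;> rfl

theorem idle_entry (A : Analyst X Ω) (ω : Ω) (s : FlatState X) :
    (idle n A ω s).entry = s.entry := by
  unfold idle; split_ifs <;> rfl

theorem idle_spent (A : Analyst X Ω) (ω : Ω) (s : FlatState X) :
    (idle n A ω s).spent = s.spent := by
  unfold idle; split_ifs <;> rfl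

theorem round_le_idle_round (A : Analyst X Ω) (ω : Ω) (s : FlatState X) :
    s.round ≤ (idle n A ω s).round := by
  unfold idle; split_ifs <;> simp

theorem size_le_flatStep_size (sigma : ℕ → ℝ) (ρ : ℝ) (A : Analyst X Ω) (x : Fin n → X) (ω : Ω)
    (z : ℕ → ℝ) (s : FlatState X) : s.size ≤ (flatStep sigma ρ A x ω z s).size := by
  by_cases h : Answers n sigma ρ A ω s
  · rw [flatStep_of_answers h]; exact Nat.le_succ _
  · rw [flatStep_of_not_answers h, idle_size]

/-- The size never decreases, so a run from `s` reads noise only at indices from `s.size` on. -/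
theorem flatRun_congr {sigma : ℕ → ℝ} {ρ : ℝ} {A : Analyst X Ω} {x : Fin n → X} {ω : Ω}
    {z z' : ℕ → ℝ} (N : ℕ) {s : FlatState X} (h : ∀ i, s.size ≤ i → z i = z' i) :
    flatRun sigma ρ A x ω z N s = flatRun sigma ρ A x ω z' N s := by
  induction N generalizing s with
  | zero => rfl
  | succ N ih =>
    have hs : flatStep sigma ρ A x ω z s = flatStep sigma ρ A x ω z' s := by
      unfold flatStep
      rw [h _ le_rfl]
    rw [flatRun_succ, flatRun_succ, hs]
    exact ih fun i hi => h i ((size_le_flatStep_size sigma ρ A x ω z' s).trans hi)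

/-- The expectation, over the noise, of a function of the state `N` steps after `s`. -/
def flatExp (sigma : ℕ → ℝ) (ρ : ℝ) (A : Analyst X Ω) (x : Fin n → X) (ω : Ω)
    (f : FlatState X → ℝ≥0∞) (N : ℕ) (s : FlatState X) : ℝ≥0∞ :=
  ∫⁻ z, f (flatRun sigma ρ A x ω z N s) ∂noise

variable {sigma : ℕ → ℝ} {ρ : ℝ} {A : Analyst X Ω} {x x' : Fin n → X} {ω : Ω}
  {f : FlatState X → ℝ≥0∞}

theorem flatExp_zero (s : FlatState X) : flatExp sigma ρ A x ω f 0 s = f s := by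
  simp [flatExp, flatRun]

theorem flatExp_succ_of_not_answers (N : ℕ) {s : FlatState X}
    (h : ¬ Answers n sigma ρ A ω s) :
    flatExp sigma ρ A x ω f (N + 1) s = flatExp sigma ρ A x ω f N (idle n A ω s) := by
  unfold flatExp
  simp only [flatRun_succ, flatStep_of_not_answers h]

theorem measurable_flatExp (hf : Measurable f) (N : ℕ) :
    Measurable (flatExp sigma ρ A x ω f N) := by
  refine Measurable.lintegral_prod_right' (f := fun p : FlatState X × (ℕ → ℝ) =>
    f (flatRun sigma ρ A x ω p.2 N p.1)) (hf.comp ?_)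
  exact (measurable_flatRun sigma ρ A x N).comp (by fun_prop :
    Measurable fun p : FlatState X × (ℕ → ℝ) => (ω, p.2, p.1))

theorem measurable_answer_noise (s : FlatState X) :
    Measurable fun y => answer sigma A x ω y s :=
  (measurable_answer sigma A x).comp (by fun_prop : Measurable fun y : ℝ => (ω, y, s))

/-- The noise used now sits at index `s.size` and is never read again. Resampling it therefore
separates it from the rest of the run, which is the Markov property of the interaction. -/
theorem flatExp_succ_of_answers (hf : Measurable f) (N : ℕ) {s : FlatState X}
    (h : Answers n sigma ρ A ω s) :
    flatExp sigma ρ A x ω f (N + 1) s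
      = ∫⁻ y, flatExp sigma ρ A x ω f N (answer sigma A x ω y s) ∂gaussianReal 0 1 := by
  unfold flatExp
  have hmeas : Measurable fun z => f (flatRun sigma ρ A x ω z (N + 1) s) :=
    hf.comp ((measurable_flatRun sigma ρ A x (N + 1)).comp (by fun_prop :
      Measurable fun z : ℕ → ℝ => (ω, z, s)))
  have hans := measurable_answer_noise (sigma := sigma) (A := A) (x := x) (ω := ω) s
  rw [noise, lintegral_infinitePi_update _ s.size hmeas, ← noise, lintegral_lintegral_swap]
  · refine lintegral_congr fun y => lintegral_congr fun z => ?_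
    rw [flatRun_succ, flatStep_of_answers h, Function.update_self]
    congr 1
    refine flatRun_congr N fun i hi => Function.update_of_ne ?_ _ _
    have : s.size + 1 ≤ i := hi
    omega
  · exact (hmeas.comp (measurable_update_pair s.size)).aemeasurable

theorem prefixValue_sub_le (q : StatQuery X) (t : ℕ) {τ : Fin n} (h : ∀ j, j ≠ τ → x j = x' j) :
    |prefixValue q t x - prefixValue q t x'| ≤ 1 / t := by
  unfold prefixValue
  rw [← sub_div, ← Finset.sum_sub_distrib, abs_div, Nat.abs_cast]
  gcongr
  rw [Finset.sum_eq_single τ (fun j _ hj => by rw [h j hj, sub_self]) (by simp)]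
  have h1 := (q (x τ)).2
  have h2 := (q (x' τ)).2
  split_ifs
  · rw [abs_le]; constructor <;> linarith [h1.1, h1.2, h2.1, h2.2]
  · simp

/-- The coefficient of the Rényi moment in the conversion to approximate differential privacy. -/
def renyiCoeff (γ ε : ℝ) : ℝ := Real.exp (-((γ - 1) * ε)) * (1 - γ⁻¹) ^ γ / (γ - 1)

theorem renyiCoeff_nonneg {γ : ℝ} (hγ : 1 < γ) (ε : ℝ) : 0 ≤ renyiCoeff γ ε := by
  have h1 := inv_le_one_of_one_le₀ hγ.le
  have h2 : 0 ≤ 1 - γ⁻¹ := by linarith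
  have h3 : 0 < γ - 1 := by linarith
  unfold renyiCoeff
  positivity

/-- Here `a` stands for the likelihood ratio of the past. Releasing an answer multiplies `a` by a
Gaussian density ratio, and the mean of the `γ`-th power of that factor is paid for by the drop in
the remaining budget `ρ - s.spent`. The conversion to `(ε, δ)` happens only at the end of the run,
so it is not lossily composed. -/
theorem flatExp_le (hσ : ∀ t, 0 < sigma t) {τ : Fin n} (hx : ∀ j, j ≠ τ → x j = x' j)
    (hf : Measurable f) (hf1 : ∀ s, f s ≤ 1) {γ : ℝ} (hγ : 1 < γ) (ε : ℝ) (N : ℕ)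
    {s : FlatState X} {a : ℝ} (ha : 0 ≤ a) (hs : s.spent ≤ ρ) :
    ENNReal.ofReal a * flatExp sigma ρ A x ω f N s
      ≤ ENNReal.ofReal (Real.exp ε) * flatExp sigma ρ A x' ω f N s
        + ENNReal.ofReal (renyiCoeff γ ε * a ^ γ
          * Real.exp (γ * (γ - 1) * (ρ - s.spent))) := by
  have hK := renyiCoeff_nonneg hγ ε
  have hγ' : 0 ≤ γ * (γ - 1) := mul_nonneg (by linarith) (by linarith)
  induction N generalizing s a with
  | zero =>
    rw [flatExp_zero, flatExp_zero]
    have hle : a ≤ Real.exp ε + renyiCoeff γ ε * a ^ γ := le_exp_add_rpow ha hγ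
    -- Budget left over at the end only weakens the bound.
    have h1 : renyiCoeff γ ε * a ^ γ
        ≤ renyiCoeff γ ε * a ^ γ * Real.exp (γ * (γ - 1) * (ρ - s.spent)) := by
      refine le_mul_of_one_le_right (by positivity) (Real.one_le_exp ?_)
      exact mul_nonneg hγ' (by linarith)
    calc _ ≤ (ENNReal.ofReal (Real.exp ε) + ENNReal.ofReal (renyiCoeff γ ε * a ^ γ)) * f s := by
          rw [← ENNReal.ofReal_add (Real.exp_nonneg _) (by positivity)]
          gcongr
      _ ≤ ENNReal.ofReal (Real.exp ε) * f s + ENNReal.ofReal (renyiCoeff γ ε * a ^ γ) * 1 := by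
          rw [add_mul]
          gcongr
          exact hf1 s
      _ ≤ _ := by
          rw [mul_one]
          gcongr
  | succ N ih =>
    by_cases h : Answers n sigma ρ A ω s
    swap
    · rw [flatExp_succ_of_not_answers N h, flatExp_succ_of_not_answers N h]
      have := ih (s := idle n A ω s) ha (by rwa [idle_spent])
      rwa [idle_spent] at this
    rw [flatExp_succ_of_answers hf N h, flatExp_succ_of_answers hf N h]
    set q := nextQuery A ω s with hq
    set t := s.round with ht
    set c := (prefixValue q t x - prefixValue q t x') / sigma t with hc
    -- The same answer arises on `x'` from noise translated by `c`, so the runs on the two datasets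
    -- can be compared by a change of density.
    have hshift (y : ℝ) : answer sigma A x ω y s = answer sigma A x' ω (y + c) s := by
      unfold answer
      rw [← hq, ← ht, mul_add, hc, mul_div_cancel₀ _ (hσ t).ne']
      congr 5
      ring
    have hcost : c ^ 2 / 2 ≤ cost sigma t := by
      have h1 : c ^ 2 ≤ (1 / t / sigma t) ^ 2 := by
        rw [sq_le_sq, hc, abs_div, abs_div, abs_of_pos (hσ t), abs_of_nonneg (by positivity :
          (0 : ℝ) ≤ 1 / t)]
        have := (hσ t).le
        gcongr
        exact prefixValue_sub_le q t hx
      calc c ^ 2 / 2 ≤ (1 / t / sigma t) ^ 2 / 2 := by gcongr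
        _ = cost sigma t := by unfold cost; field_simp
    have hansm := measurable_answer_noise (sigma := sigma) (A := A) (x := x') (ω := ω) s
    have hm := (measurable_flatExp (sigma := sigma) (ρ := ρ) (A := A) (x := x) (ω := ω) hf N).comp
      hansm
    have hm' := (measurable_flatExp (sigma := sigma) (ρ := ρ) (A := A) (x := x') (ω := ω)
      hf N).comp hansm
    simp only [Function.comp_def] at hm hm'
    have hgir : ∫⁻ y, flatExp sigma ρ A x ω f N (answer sigma A x ω y s) ∂gaussianReal 0 1
        = ∫⁻ y, ENNReal.ofReal (Real.exp (c * y - c ^ 2 / 2)) *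
          flatExp sigma ρ A x ω f N (answer sigma A x' ω y s) ∂gaussianReal 0 1 := by
      rw [← lintegral_gaussianReal_add c hm]
      simp only [hshift]
    set B := Real.exp (γ * (γ - 1) * (ρ - (s.spent + cost sigma t))) with hB
    rw [hgir, ← lintegral_const_mul _ (by fun_prop), ← lintegral_const_mul _ hm']
    calc _ ≤ ∫⁻ y, (ENNReal.ofReal (Real.exp ε) *
            flatExp sigma ρ A x' ω f N (answer sigma A x' ω y s)
          + ENNReal.ofReal (renyiCoeff γ ε * a ^ γ * B) *
            ENNReal.ofReal (Real.exp (c * y - c ^ 2 / 2) ^ γ)) ∂gaussianReal 0 1 := by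
          refine lintegral_mono fun y => ?_
          -- The density joins the accumulated ratio; the filter's test, the last component of `h`,
          -- keeps the spent level below `ρ`.
          have := ih (s := answer sigma A x' ω y s) (a := a * Real.exp (c * y - c ^ 2 / 2))
            (by positivity) h.2.2.2
          rw [← mul_assoc, ← ENNReal.ofReal_mul ha]
          refine this.trans_eq ?_
          congr 1
          rw [← ENNReal.ofReal_mul (by positivity), Real.mul_rpow ha (Real.exp_nonneg _)]
          congr 1
          change _ * Real.exp (γ * (γ - 1) * (ρ - (s.spent + cost sigma t))) = _
          rw [hB]
          ring
      _ = (∫⁻ y, ENNReal.ofReal (Real.exp ε) *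
            flatExp sigma ρ A x' ω f N (answer sigma A x' ω y s) ∂gaussianReal 0 1)
          + ENNReal.ofReal (renyiCoeff γ ε * a ^ γ * B) *
            ENNReal.ofReal (Real.exp (γ * (γ - 1) * (c ^ 2 / 2))) := by
          rw [lintegral_add_left (by fun_prop)]
          congr 1
          rw [lintegral_const_mul' _ _ ENNReal.ofReal_ne_top, lintegral_gaussianReal_exp_rpow]
      _ ≤ _ := by
          gcongr
          rw [← ENNReal.ofReal_mul (by positivity), mul_assoc _ B, hB, ← Real.exp_add]
          gcongr
          nlinarith [mul_le_mul_of_nonneg_left hcost hγ']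

theorem deltaOf_nonneg (ρ ε : ℝ) : 0 ≤ deltaOf ρ ε := by
  refine Real.iInf_nonneg fun γ => ?_
  have hγ : (1 : ℝ) < γ := γ.2
  have h1 := inv_le_one_of_one_le₀ hγ.le
  have h2 : 0 ≤ 1 - (γ : ℝ)⁻¹ := by linarith
  have h3 : 0 < (γ : ℝ) - 1 := by linarith
  positivity

/-- The state of the interaction after any number of steps is an approximately differentially
private function of the dataset. -/
theorem flatExp_le_deltaOf (hσ : ∀ t, 0 < sigma t) {τ : Fin n} (hx : ∀ j, j ≠ τ → x j = x' j)
    (hf : Measurable f) (hf1 : ∀ s, f s ≤ 1) (ε : ℝ) (N : ℕ)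
    {s : FlatState X} (hρ : 0 ≤ ρ) (hs : s.spent = 0) :
    flatExp sigma ρ A x ω f N s
      ≤ ENNReal.ofReal (Real.exp ε) * flatExp sigma ρ A x' ω f N s
        + ENNReal.ofReal (deltaOf ρ ε) := by
  have hle1 (x : Fin n → X) : flatExp sigma ρ A x ω f N s ≤ 1 := by
    unfold flatExp
    calc _ ≤ ∫⁻ _, 1 ∂noise := lintegral_mono fun z => hf1 _
      _ = 1 := by simp
  have hfin (x : Fin n → X) : flatExp sigma ρ A x ω f N s ≠ ∞ :=
    ((hle1 x).trans_lt ENNReal.one_lt_top).ne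
  have key : (flatExp sigma ρ A x ω f N s).toReal
      - Real.exp ε * (flatExp sigma ρ A x' ω f N s).toReal ≤ deltaOf ρ ε := by
    have : Nonempty (Set.Ioi (1 : ℝ)) := ⟨⟨2, by norm_num⟩⟩
    -- The bound holds for each order `γ` separately, with initial ratio `a = 1`, and so passes to
    -- the infimum.
    refine le_ciInf fun γ => ?_
    have hγ : (1 : ℝ) < γ := γ.2
    have hK := renyiCoeff_nonneg hγ ε
    have h := flatExp_le (A := A) (ω := ω) hσ hx hf hf1 hγ ε N zero_le_one
      (by rw [hs]; exact hρ : s.spent ≤ ρ)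
    rw [ENNReal.ofReal_one, one_mul, Real.one_rpow, mul_one, hs, sub_zero,
      ← ENNReal.ofReal_toReal (hfin x), ← ENNReal.ofReal_toReal (hfin x'),
      ← ENNReal.ofReal_mul (Real.exp_nonneg _),
      ← ENNReal.ofReal_add (by positivity) (by positivity),
      ENNReal.ofReal_le_ofReal_iff (by positivity)] at h
    have heq : renyiCoeff γ ε * Real.exp (γ * (γ - 1) * ρ)
        = Real.exp (((γ : ℝ) - 1) * (γ * ρ - ε)) * (1 - (γ : ℝ)⁻¹) ^ (γ : ℝ) / ((γ : ℝ) - 1) := by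
      rw [show ((γ : ℝ) - 1) * (γ * ρ - ε) = -((γ - 1) * ε) + γ * (γ - 1) * ρ by ring,
        Real.exp_add]
      unfold renyiCoeff
      ring
    linarith
  rw [← ENNReal.ofReal_toReal (hfin x), ← ENNReal.ofReal_toReal (hfin x'),
      ← ENNReal.ofReal_mul (Real.exp_nonneg _),
      ← ENNReal.ofReal_add (by positivity) (deltaOf_nonneg ρ ε)]
  exact ENNReal.ofReal_le_ofReal (by linarith)

end Privacy

/-! ### From privacy to generalisation: empirical values versus means. -/

section Transfer

variable {X Ω : Type*} {n : ℕ}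

theorem prefixValue_nonneg (q : StatQuery X) (t : ℕ) (x : Fin n → X) : 0 ≤ prefixValue q t x :=
  div_nonneg (Finset.sum_nonneg fun τ _ => by
    split_ifs
    · exact (q (x τ)).2.1
    · exact le_rfl) (Nat.cast_nonneg t)

theorem sum_ite_lt {t : ℕ} (ht : t ≤ n) (c : ℝ) :
    (∑ τ : Fin n, if (τ : ℕ) < t then c else 0) = t * c := by
  rw [← Finset.sum_filter, Finset.sum_const, nsmul_eq_mul]
  congr 2
  rw [Fin.card_filter_val_lt, min_eq_right ht]

theorem prefixValue_symm {t : ℕ} (h1 : 1 ≤ t) (ht : t ≤ n) (q : StatQuery X) (x : Fin n → X) :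
    prefixValue (fun v => unitInterval.symm (q v)) t x = 1 - prefixValue q t x := by
  have h0 : (t : ℝ) ≠ 0 := by positivity
  have h2 := sum_ite_lt ht 1
  unfold prefixValue
  rw [eq_sub_iff_add_eq, ← add_div, ← Finset.sum_add_distrib, div_eq_one_iff_eq h0, ← mul_one (t : ℝ),
    ← h2]
  refine Finset.sum_congr rfl fun τ _ => ?_
  split_ifs <;> simp

theorem prefixValue_le_one {t : ℕ} (h1 : 1 ≤ t) (ht : t ≤ n) (q : StatQuery X) (x : Fin n → X) :
    prefixValue q t x ≤ 1 := by
  have := prefixValue_nonneg (fun v => unitInterval.symm (q v)) t x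
  rw [prefixValue_symm h1 ht] at this
  linarith

/-- The contribution of the data point `v` in position `j` to the value of a selected query. -/
def contribution (D : Set (FlatState X)) (T : FlatState X → ℕ) (Q : FlatState X → StatQuery X)
    (j : ℕ) (s : FlatState X) (v : X) : ℝ≥0∞ :=
  D.indicator (fun s => if j < T s then ENNReal.ofReal (Q s v / T s) else 0) s

variable {D : Set (FlatState X)} {T : FlatState X → ℕ} {Q : FlatState X → StatQuery X} {n₀ : ℕ}

theorem sum_contribution (x : Fin n → X) (s : FlatState X) :
    ∑ τ : Fin n, contribution D T Q τ s (x τ)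
      = D.indicator (fun s => ENNReal.ofReal (prefixValue (Q s) (T s) x)) s := by
  unfold contribution
  by_cases hs : s ∈ D
  · simp only [Set.indicator_of_mem hs, prefixValue, Finset.sum_div]
    rw [ENNReal.ofReal_sum_of_nonneg]
    · refine Finset.sum_congr rfl fun τ _ => ?_
      split_ifs <;> simp
    · intro τ _
      split_ifs
      · exact div_nonneg (Q s (x τ)).2.1 (Nat.cast_nonneg _)
      · simp
  · simp [Set.indicator_of_notMem hs]

/-- A query of round `T s` weighs each point by `1 / T s`, and `T s` is at least `n₀`. Scaling by
`n₀` thus gives a test function bounded by one, and undoing the scaling turns `δ` into `δ / n₀`. -/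
theorem contribution_le (hn₀ : 1 ≤ n₀) (hD : ∀ s ∈ D, n₀ ≤ T s ∧ T s ≤ n) (j : ℕ)
    (s : FlatState X) (v : X) : (n₀ : ℝ≥0∞) * contribution D T Q j s v ≤ 1 := by
  unfold contribution
  by_cases hs : s ∈ D
  · rw [Set.indicator_of_mem hs]
    split_ifs
    · have h1 : (0 : ℝ) < T s := by
        have := (hD s hs).1
        exact_mod_cast (by omega : 0 < T s)
      have h2 : (n₀ : ℝ) ≤ T s := by exact_mod_cast (hD s hs).1
      rw [← ENNReal.ofReal_natCast, ← ENNReal.ofReal_mul (by positivity), ← ENNReal.ofReal_one]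
      refine ENNReal.ofReal_le_ofReal ?_
      rw [← mul_div_assoc, div_le_one h1]
      exact (mul_le_of_le_one_right (by positivity) (Q s v).2.2).trans h2
    · simp
  · simp [Set.indicator_of_notMem hs]

variable [MeasurableSpace X]

/-- The mean of a query under the data distribution. -/
def queryMean (P : Measure X) (q : StatQuery X) : ℝ :=
  ∫ v, (q v : ℝ) ∂P

theorem queryMean_nonneg (P : Measure X) (q : StatQuery X) : 0 ≤ queryMean P q :=
  integral_nonneg fun v => (q v).2.1

variable [Finite X] [MeasurableSingletonClass X]

theorem measurable_query (q : StatQuery X) : Measurable fun v => (q v : ℝ) :=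
  measurable_of_countable _

theorem integrable_query (P : Measure X) [IsProbabilityMeasure P] (q : StatQuery X) :
    Integrable (fun v => (q v : ℝ)) P :=
  Integrable.of_bound (measurable_query q).aestronglyMeasurable 1
    (Filter.Eventually.of_forall fun v => by
      rw [Real.norm_of_nonneg (q v).2.1]; exact (q v).2.2)

theorem queryMean_le_one (P : Measure X) [IsProbabilityMeasure P] (q : StatQuery X) :
    queryMean P q ≤ 1 := by
  calc queryMean P q ≤ ∫ _, (1 : ℝ) ∂P :=
        integral_mono (integrable_query P q) (integrable_const _) fun v => (q v).2.2
    _ = 1 := by simp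

theorem measurable_queryMean (P : Measure X) [IsProbabilityMeasure P] :
    Measurable (queryMean P) := by
  have := Fintype.ofFinite X
  have h : queryMean P = fun q => ∑ v, P.real {v} * (q v : ℝ) := by
    ext q
    simp [queryMean, integral_fintype (integrable_query P q)]
  rw [h]
  fun_prop

theorem populationValue_eq_queryMean (P : Measure X) [IsProbabilityMeasure P] {t : ℕ} (ht : 1 ≤ t)
    (q : StatQuery X) : populationValue P t q = queryMean P q := by
  unfold populationValue snapshotValue
  rw [integral_div, integral_finsetSum]
  · have h (τ : Fin t) : ∫ y : Fin t → X, (q (y τ) : ℝ) ∂(Measure.pi fun _ : Fin t => P)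
        = queryMean P q :=
      integral_comp_eval (μ := fun _ : Fin t => P) (f := fun v => (q v : ℝ))
        (measurable_query q).aestronglyMeasurable
    simp only [h]
    have : (t : ℝ) ≠ 0 := by positivity
    simp [this]
  · exact fun τ _ => (measurePreserving_eval (fun _ : Fin t => P) τ).integrable_comp_of_integrable
      (integrable_query P q)

theorem queryMean_symm (P : Measure X) [IsProbabilityMeasure P] (q : StatQuery X) :
    queryMean P (fun v => unitInterval.symm (q v)) = 1 - queryMean P q := by
  unfold queryMean
  simp only [unitInterval.coe_symm_eq]
  rw [integral_sub (integrable_const _) (integrable_query P q)]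
  simp

variable [MeasurableSpace Ω] {sigma : ℕ → ℝ} {ρ : ℝ} {A : Analyst X Ω}

/-- There are finitely many datasets, so measurability need only be checked for each one. -/
theorem measurable_flatRun_joint (N : ℕ) (s₀ : FlatState X) :
    Measurable fun w : (Fin n → X) × Ω × (ℕ → ℝ) =>
      flatRun sigma ρ A w.1 w.2.1 w.2.2 N s₀ := by
  refine measurable_from_prod_countable_right fun x => ?_
  exact (measurable_flatRun sigma ρ A x N).comp (by fun_prop :
    Measurable fun p : Ω × (ℕ → ℝ) => (p.1, p.2, s₀))

theorem measurable_contribution (hDm : MeasurableSet D) (hT : Measurable T) (hQ : Measurable Q)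
    (j : ℕ) : Measurable fun p : FlatState X × X => contribution D T Q j p.1 p.2 := by
  refine measurable_from_prod_countable_left fun v => Measurable.indicator ?_ hDm
  refine Measurable.ite (hT measurableSet_Ioi) ?_ measurable_const
  have h1 : Measurable fun s => (T s : ℝ) := measurable_from_nat.comp hT
  have h2 : Measurable fun s => (Q s v : ℝ) :=
    measurable_subtype_coe.comp ((measurable_pi_apply v).comp hQ)
  fun_prop

theorem sum_lintegral_contribution (hn₀ : 1 ≤ n₀) (hD : ∀ s ∈ D, n₀ ≤ T s ∧ T s ≤ n)
    (P : Measure X) [IsProbabilityMeasure P] (s : FlatState X) :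
    ∑ τ : Fin n, ∫⁻ v, contribution D T Q τ s v ∂P
      = D.indicator (fun s => ENNReal.ofReal (queryMean P (Q s))) s := by
  unfold contribution
  by_cases hs : s ∈ D
  · simp only [Set.indicator_of_mem hs]
    have h0 : (T s : ℝ) ≠ 0 := by
      have := (hD s hs).1
      exact_mod_cast (by omega : T s ≠ 0)
    have h1 : ∫⁻ v, ENNReal.ofReal (Q s v / T s) ∂P
        = ENNReal.ofReal (queryMean P (Q s) / T s) := by
      rw [← ofReal_integral_eq_lintegral_ofReal ((integrable_query P (Q s)).div_const _)
        (Filter.Eventually.of_forall fun v => div_nonneg (Q s v).2.1 (Nat.cast_nonneg _)),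
        integral_div]
      rfl
    have h2 (τ : Fin n) : (∫⁻ v, if (τ : ℕ) < T s then ENNReal.ofReal (Q s v / T s) else 0 ∂P)
        = ENNReal.ofReal (if (τ : ℕ) < T s then queryMean P (Q s) / T s else 0) := by
      split_ifs
      · exact h1
      · simp
    have hm := queryMean_nonneg P (Q s)
    simp only [h2]
    rw [← ENNReal.ofReal_sum_of_nonneg, sum_ite_lt (hD s hs).2, mul_div_cancel₀ _ h0]
    intro τ _
    split_ifs
    · positivity
    · exact le_rfl
  · simp [Set.indicator_of_notMem hs]

instance (P : Measure X) [IsProbabilityMeasure P] (μ : Measure Ω) [IsProbabilityMeasure μ] :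
    IsProbabilityMeasure (jointLaw n P μ) := by
  unfold jointLaw
  infer_instance

/-- Let `G (x, v)` be the expected contribution of `v` in position `τ` when the interaction runs on
`x`. By privacy, overwriting `x τ` with a fresh point `y` changes it by little. After that the
interaction no longer sees `x τ`, and the pair of modified dataset and `x τ` is distributed as a
dataset with an independent point. -/
theorem lintegral_contribution_le (hn₀ : 1 ≤ n₀) (hσ : ∀ t, 0 < sigma t) (hρ : 0 ≤ ρ)
    (P : Measure X) [IsProbabilityMeasure P] (μ : Measure Ω) [IsProbabilityMeasure μ]
    (hDm : MeasurableSet D) (hT : Measurable T) (hQ : Measurable Q)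
    (hD : ∀ s ∈ D, n₀ ≤ T s ∧ T s ≤ n) (ε : ℝ) (N : ℕ) {s₀ : FlatState X} (hs₀ : s₀.spent = 0)
    (τ : Fin n) :
    ∫⁻ w, contribution D T Q τ (flatRun sigma ρ A w.1 w.2.1 w.2.2 N s₀) (w.1 τ) ∂jointLaw n P μ
      ≤ ENNReal.ofReal (Real.exp ε) *
          ∫⁻ w, ∫⁻ v, contribution D T Q τ (flatRun sigma ρ A w.1 w.2.1 w.2.2 N s₀) v ∂P
            ∂jointLaw n P μ
        + ENNReal.ofReal (deltaOf ρ ε / n₀) := by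
  have hn0' : (n₀ : ℝ≥0∞) ≠ 0 := by simp; omega
  have hS := measurable_flatRun_joint (n := n) (sigma := sigma) (ρ := ρ) (A := A) N s₀
  have hc := measurable_contribution hDm hT hQ τ
  set g := contribution D T Q τ with hg
  set G : (Fin n → X) × X → ℝ≥0∞ := fun q =>
    ∫⁻ p, g (flatRun sigma ρ A q.1 p.1 p.2 N s₀) q.2 ∂μ.prod noise with hG
  have hjoint : Measurable fun r : ((Fin n → X) × X) × Ω × (ℕ → ℝ) =>
      g (flatRun sigma ρ A r.1.1 r.2.1 r.2.2 N s₀) r.1.2 :=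
    hc.comp ((hS.comp (by fun_prop : Measurable fun r : ((Fin n → X) × X) × Ω × (ℕ → ℝ) =>
      (r.1.1, r.2))).prodMk (by fun_prop))
  have hGm : Measurable G := hjoint.lintegral_prod_right'
  have hpriv (x : Fin n → X) (y v : X) : G (x, v)
      ≤ ENNReal.ofReal (Real.exp ε) * G (Function.update x τ y, v)
        + ENNReal.ofReal (deltaOf ρ ε / n₀) := by
    have hfix (x : Fin n → X) : Measurable fun p : Ω × (ℕ → ℝ) =>
        g (flatRun sigma ρ A x p.1 p.2 N s₀) v :=
      hjoint.comp (by fun_prop : Measurable fun p : Ω × (ℕ → ℝ) => ((x, v), p))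
    simp only [hG]
    rw [lintegral_prod _ (hfix x).aemeasurable, lintegral_prod _ (hfix _).aemeasurable,
      ← lintegral_const_mul' _ _ ENNReal.ofReal_ne_top]
    have hpt (ω : Ω) : ∫⁻ z, g (flatRun sigma ρ A x ω z N s₀) v ∂noise
        ≤ ENNReal.ofReal (Real.exp ε) *
          ∫⁻ z, g (flatRun sigma ρ A (Function.update x τ y) ω z N s₀) v ∂noise
          + ENNReal.ofReal (deltaOf ρ ε / n₀) := by
      -- Privacy is used for each fixed seed of the analyst, with the scaled contribution as test
      -- function.
      have h := flatExp_le_deltaOf (A := A) (ω := ω) (x := x) (x' := Function.update x τ y)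
        (f := fun s => n₀ * g s v) hσ (fun j hj => (Function.update_of_ne hj _ _).symm)
        ((hc.comp (by fun_prop : Measurable fun s : FlatState X => (s, v))).const_mul _)
        (fun s => contribution_le hn₀ hD τ s v) ε N hρ hs₀
      unfold flatExp at h
      rw [lintegral_const_mul' _ _ (ENNReal.natCast_ne_top _),
        lintegral_const_mul' _ _ (ENNReal.natCast_ne_top _)] at h
      rw [← ENNReal.mul_le_mul_iff_right hn0' (ENNReal.natCast_ne_top n₀)]
      refine h.trans_eq ?_
      rw [mul_add, mul_left_comm]
      congr 1
      rw [← ENNReal.ofReal_natCast, ← ENNReal.ofReal_mul (by positivity)]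
      congr 1
      have : (n₀ : ℝ) ≠ 0 := by positivity
      field_simp
    calc _ ≤ ∫⁻ ω, (ENNReal.ofReal (Real.exp ε) *
            ∫⁻ z, g (flatRun sigma ρ A (Function.update x τ y) ω z N s₀) v ∂noise
            + ENNReal.ofReal (deltaOf ρ ε / n₀)) ∂μ := lintegral_mono hpt
      _ = _ := by
        rw [lintegral_add_right _ measurable_const, lintegral_const, measure_univ, mul_one]
  have hleft : ∫⁻ w, g (flatRun sigma ρ A w.1 w.2.1 w.2.2 N s₀) (w.1 τ) ∂jointLaw n P μ
      = ∫⁻ x, G (x, x τ) ∂(Measure.pi fun _ : Fin n => P) := by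
    unfold jointLaw
    rw [lintegral_prod]
    exact (hjoint.comp (by fun_prop : Measurable fun w : (Fin n → X) × Ω × (ℕ → ℝ) =>
      ((w.1, w.1 τ), w.2))).aemeasurable
  have hright : ∫⁻ w, ∫⁻ v, g (flatRun sigma ρ A w.1 w.2.1 w.2.2 N s₀) v ∂P ∂jointLaw n P μ
      = ∫⁻ x, ∫⁻ v, G (x, v) ∂P ∂(Measure.pi fun _ : Fin n => P) := by
    unfold jointLaw
    rw [lintegral_prod]
    · refine lintegral_congr fun x => lintegral_lintegral_swap ?_
      exact (hjoint.comp (by fun_prop : Measurable fun r : (Ω × (ℕ → ℝ)) × X =>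
        ((x, r.2), r.1))).aemeasurable
    · exact (Measurable.lintegral_prod_right' (f := fun r : ((Fin n → X) × Ω × (ℕ → ℝ)) × X =>
        g (flatRun sigma ρ A r.1.1 r.1.2.1 r.1.2.2 N s₀) r.2) (hjoint.comp (by fun_prop :
          Measurable fun r : ((Fin n → X) × Ω × (ℕ → ℝ)) × X =>
            ((r.1.1, r.2), r.1.2)))).aemeasurable
  rw [hleft, hright, ← lintegral_pi_update_swap P τ hGm]
  calc _ = ∫⁻ x, ∫⁻ _, G (x, x τ) ∂P ∂(Measure.pi fun _ : Fin n => P) := by simp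
    _ ≤ ∫⁻ x, ∫⁻ y, (ENNReal.ofReal (Real.exp ε) * G (Function.update x τ y, x τ)
        + ENNReal.ofReal (deltaOf ρ ε / n₀)) ∂P ∂(Measure.pi fun _ : Fin n => P) :=
      lintegral_mono fun x => lintegral_mono fun y => hpriv x y (x τ)
    _ = _ := by
      simp only [lintegral_add_right _ measurable_const, lintegral_const, measure_univ, mul_one,
        lintegral_const_mul' _ _ ENNReal.ofReal_ne_top]

/-- A query selected by a privately computed state has nearly the same value on the data as on
the distribution. -/
theorem lintegral_selected_le (hn₀ : 1 ≤ n₀) (hσ : ∀ t, 0 < sigma t) (hρ : 0 ≤ ρ)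
    (P : Measure X) [IsProbabilityMeasure P] (μ : Measure Ω) [IsProbabilityMeasure μ]
    (hDm : MeasurableSet D) (hT : Measurable T) (hQ : Measurable Q)
    (hD : ∀ s ∈ D, n₀ ≤ T s ∧ T s ≤ n) (ε : ℝ) (N : ℕ) {s₀ : FlatState X} (hs₀ : s₀.spent = 0) :
    ∫⁻ w, D.indicator (fun s => ENNReal.ofReal (prefixValue (Q s) (T s) w.1))
        (flatRun sigma ρ A w.1 w.2.1 w.2.2 N s₀) ∂jointLaw n P μ
      ≤ ENNReal.ofReal (Real.exp ε) *
          ∫⁻ w, D.indicator (fun s => ENNReal.ofReal (queryMean P (Q s)))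
            (flatRun sigma ρ A w.1 w.2.1 w.2.2 N s₀) ∂jointLaw n P μ
        + ENNReal.ofReal (n * deltaOf ρ ε / n₀) := by
  have hS := measurable_flatRun_joint (n := n) (sigma := sigma) (ρ := ρ) (A := A) N s₀
  simp only [← sum_contribution, ← sum_lintegral_contribution (Q := Q) hn₀ hD P]
  rw [lintegral_finsetSum, lintegral_finsetSum, Finset.mul_sum]
  · refine (Finset.sum_le_sum fun τ _ => lintegral_contribution_le (A := A) hn₀ hσ hρ P μ hDm hT
      hQ hD ε N hs₀ τ).trans_eq ?_
    rw [Finset.sum_add_distrib, Finset.sum_const, Finset.card_univ, Fintype.card_fin, nsmul_eq_mul,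
      ← ENNReal.ofReal_natCast, ← ENNReal.ofReal_mul (by positivity), mul_div_assoc]
  · intro τ _
    exact Measurable.lintegral_prod_right' (f := fun r : ((Fin n → X) × Ω × (ℕ → ℝ)) × X =>
      contribution D T Q τ (flatRun sigma ρ A r.1.1 r.1.2.1 r.1.2.2 N s₀) r.2)
      ((measurable_contribution hDm hT hQ τ).comp
        ((hS.comp measurable_fst).prodMk measurable_snd))
  · intro τ _
    exact (measurable_contribution hDm hT hQ τ).comp (hS.prodMk (by fun_prop))

end Transfer

/-! ### Noise tails and the probability of a first error within a fixed number of steps. -/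

section Accuracy

/-- Every entry of the transcript is the clipped noisy value of its query on a snapshot, in a
round from `n₀` to `n`. -/
def Consistent {X : Type*} {n : ℕ} (n₀ : ℕ) (sigma : ℕ → ℝ) (x : Fin n → X) (z : ℕ → ℝ)
    (s : FlatState X) : Prop :=
  n₀ ≤ s.round ∧ ∀ i < s.size, n₀ ≤ (s.entry i).1 ∧ (s.entry i).1 ≤ n ∧
    (s.entry i).2.2
      = clamp (prefixValue (s.entry i).2.1 (s.entry i).1 x + sigma (s.entry i).1 * z i)

section Runs

variable {X Ω : Type*} [MeasurableSpace Ω] {n n₀ : ℕ} {sigma : ℕ → ℝ} {x : Fin n → X}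
  {z : ℕ → ℝ}

theorem Consistent.flatStep {s : FlatState X} (h : Consistent n₀ sigma x z s) (ρ : ℝ)
    (A : Analyst X Ω) (ω : Ω) :
    Consistent n₀ sigma x z (flatStep sigma ρ A x ω z s) := by
  by_cases ha : Answers n sigma ρ A ω s
  · rw [flatStep_of_answers ha]
    refine ⟨h.1, fun i hi => ?_⟩
    change n₀ ≤ (Function.update s.entry s.size _ i).1 ∧ _
    rcases (Nat.lt_succ_iff_lt_or_eq.1 hi) with hi | rfl
    · simpa only [answer, Function.update_of_ne hi.ne] using h.2 i hi
    · simp only [answer, Function.update_self]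
      exact ⟨h.1, ha.2.1, trivial⟩
  · rw [flatStep_of_not_answers ha]
    refine ⟨h.1.trans (round_le_idle_round A ω s), ?_⟩
    rw [idle_size, idle_entry]
    exact h.2

theorem Consistent.flatRun {s : FlatState X} (h : Consistent n₀ sigma x z s) (ρ : ℝ)
    (A : Analyst X Ω) (ω : Ω) (N : ℕ) :
    Consistent n₀ sigma x z (flatRun sigma ρ A x ω z N s) := by
  induction N generalizing s with
  | zero => exact h
  | succ N ih => exact ih (h.flatStep ρ A ω)

theorem flatten_initState_consistent :
    Consistent n₀ sigma x z (flatten (initState X n₀)) :=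
  ⟨le_rfl, fun i hi => absurd hi (Nat.not_lt_zero i)⟩

end Runs

theorem abs_clamp_add_sub_le {a b : ℝ} (h0 : 0 ≤ a) (h1 : a ≤ 1) : |clamp (a + b) - a| ≤ |b| := by
  have hc : clamp a = a := by rw [clamp, min_eq_left h1, max_eq_right h0]
  calc |clamp (a + b) - a| = |clamp (a + b) - clamp a| := by rw [hc]
    _ ≤ |min (a + b) 1 - min a 1| := by
        refine (abs_max_sub_max_le_max _ _ _ _).trans ?_
        simp
    _ ≤ |a + b - a| := by
        refine (abs_min_sub_min_le_max _ _ _ _).trans ?_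
        simp
    _ = |b| := by rw [add_sub_cancel_left]

theorem clamp_mem (a : ℝ) : 0 ≤ clamp a ∧ clamp a ≤ 1 :=
  ⟨le_max_left _ _, max_le zero_le_one (min_le_right _ _)⟩

variable {X Ω : Type*} [MeasurableSpace X] [MeasurableSpace Ω] {n n₀ : ℕ}

/-- The event that one of the first `k` noise terms is large. -/
def largeNoise (X Ω : Type*) (n k : ℕ) (u : ℝ) : Set ((Fin n → X) × Ω × (ℕ → ℝ)) :=
  ⋃ i ∈ Finset.range k, {w | Real.sqrt 2 * u < |w.2.2 i|}

theorem measurableSet_largeNoise (k : ℕ) (u : ℝ) : MeasurableSet (largeNoise X Ω n k u) :=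
  Finset.measurableSet_biUnion _ fun i _ => measurableSet_lt measurable_const
    (by fun_prop : Measurable fun w : (Fin n → X) × Ω × (ℕ → ℝ) => |w.2.2 i|)

/-- Each standardised noise term exceeds its threshold with probability at most `β / k`, by the
choice of `erfcInv`; a union bound over `k` terms suffices because the answer with index `i` uses `z
i`. -/
theorem measure_largeNoise_le (P : Measure X) [IsProbabilityMeasure P] (μ : Measure Ω)
    [IsProbabilityMeasure μ] {k : ℕ} (hk : 1 ≤ k) {β : ℝ} (h0 : 0 < β) (h1 : β < 1) :
    jointLaw n P μ (largeNoise X Ω n k (erfcInv (β / k))) ≤ ENNReal.ofReal β := by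
  set u := erfcInv (β / k) with hu
  have hk0 : (0 : ℝ) < k := by exact_mod_cast hk
  have hk1 : (1 : ℝ) ≤ k := by exact_mod_cast hk
  have hb1 : β / k < 1 := by
    rw [div_lt_one hk0]; linarith
  have hcoord (i : ℕ) : jointLaw n P μ {w | Real.sqrt 2 * u < |w.2.2 i|}
      ≤ ENNReal.ofReal (β / k) := by
    have hmp : MeasurePreserving (fun w : (Fin n → X) × Ω × (ℕ → ℝ) => w.2.2 i)
        (jointLaw n P μ) (gaussianReal 0 1) :=
      (measurePreserving_eval_infinitePi (fun _ : ℕ => gaussianReal 0 1) i).comp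
        (measurePreserving_snd.comp measurePreserving_snd)
    have hset : MeasurableSet {y : ℝ | Real.sqrt 2 * u < |y|} :=
      measurableSet_lt measurable_const (by fun_prop)
    have := hmp.measure_preimage hset.nullMeasurableSet
    calc _ = _ := this
      _ ≤ _ := gaussianReal_abs_gt_le u
      _ = _ := by rw [hu, erfc_erfcInv (by positivity) hb1]
  calc _ ≤ ∑ i ∈ Finset.range k, jointLaw n P μ {w | Real.sqrt 2 * u < |w.2.2 i|} :=
        measure_biUnion_finset_le _ _
    _ ≤ ∑ i ∈ Finset.range k, ENNReal.ofReal (β / k) := Finset.sum_le_sum fun i _ => hcoord i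
    _ = ENNReal.ofReal β := by
        rw [Finset.sum_const, Finset.card_range, nsmul_eq_mul, ← ENNReal.ofReal_natCast,
          ← ENNReal.ofReal_mul (by positivity), mul_div_cancel₀ _ hk0.ne']

/-- Whether the answer with index `i` is among the first `k` and has distributional error more
than `α`. -/
def Errs (P : Measure X) (n₀ n k : ℕ) (α : ℝ) (s : FlatState X) (i : ℕ) : Prop :=
  i < k ∧ i < s.size ∧ n₀ ≤ (s.entry i).1 ∧ (s.entry i).1 ≤ n ∧
    α < |(s.entry i).2.2 - queryMean P (s.entry i).2.1|

open Classical in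
/-- The index of the first answer with distributional error more than `α`, or `k`. -/
def firstError (P : Measure X) (n₀ n k : ℕ) (α : ℝ) (s : FlatState X) : ℕ :=
  Nat.find (⟨k, Or.inr rfl⟩ : ∃ i, Errs P n₀ n k α s i ∨ i = k)

open Classical in
theorem errs_firstError {P : Measure X} {k : ℕ} {α : ℝ} {s : FlatState X}
    (h : ∃ i, Errs P n₀ n k α s i) : Errs P n₀ n k α s (firstError P n₀ n k α s) := by
  obtain ⟨i, hi⟩ := h
  have hlt : firstError P n₀ n k α s ≤ i := Nat.find_min' _ (Or.inl hi)
  rcases Nat.find_spec (⟨k, Or.inr rfl⟩ : ∃ i, Errs P n₀ n k α s i ∨ i = k) with h | h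
  · exact h
  · have : firstError P n₀ n k α s = k := h
    exact absurd hi.1 (by omega)

variable [Finite X] [MeasurableSingletonClass X] {sigma : ℕ → ℝ} {ρ : ℝ} {A : Analyst X Ω}
  {D : Set (FlatState X)} {T : FlatState X → ℕ} {Q : FlatState X → StatQuery X}

/-- If a privately computed state selects a query whose value on the data exceeds its mean by `c`,
unless the noise is large, then this happens with small probability. -/
theorem measureReal_selected_le (hn₀ : 1 ≤ n₀) (hσ : ∀ t, 0 < sigma t) (hρ : 0 ≤ ρ)
    (P : Measure X) [IsProbabilityMeasure P] (μ : Measure Ω) [IsProbabilityMeasure μ]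
    (hDm : MeasurableSet D) (hT : Measurable T) (hQ : Measurable Q)
    (hD : ∀ s ∈ D, n₀ ≤ T s ∧ T s ≤ n) {ε : ℝ} (hε : 0 ≤ ε) (N : ℕ) {s₀ : FlatState X}
    (hs₀ : s₀.spent = 0) {bad : Set ((Fin n → X) × Ω × (ℕ → ℝ))} (hbad : MeasurableSet bad)
    {S : (Fin n → X) × Ω × (ℕ → ℝ) → FlatState X}
    (hS : S = fun w => flatRun sigma ρ A w.1 w.2.1 w.2.2 N s₀) {c : ℝ}
    (h1 : ∀ w, S w ∈ D → w ∉ bad →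
      c + queryMean P (Q (S w)) ≤ prefixValue (Q (S w)) (T (S w)) w.1)
    (h2 : ∀ w, S w ∈ D →
      c + queryMean P (Q (S w)) ≤ prefixValue (Q (S w)) (T (S w)) w.1 + 1) :
    (c - (Real.exp ε - 1)) * (jointLaw n P μ).real (S ⁻¹' D)
      ≤ n * deltaOf ρ ε / n₀ + (jointLaw n P μ).real (bad ∩ S ⁻¹' D) := by
  set J := jointLaw n P μ
  have hSm : Measurable S := hS ▸ measurable_flatRun_joint N s₀
  set pv : (Fin n → X) × Ω × (ℕ → ℝ) → ℝ :=
    (S ⁻¹' D).indicator fun w => prefixValue (Q (S w)) (T (S w)) w.1 with hpv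
  set mean : (Fin n → X) × Ω × (ℕ → ℝ) → ℝ :=
    (S ⁻¹' D).indicator fun w => queryMean P (Q (S w)) with hmean
  have hpvm : Measurable pv := by
    refine Measurable.indicator ?_ (hSm hDm)
    have h : Measurable fun p : (Fin n → X) × ℕ × StatQuery X => prefixValue p.2.2 p.2.1 p.1 :=
      measurable_from_prod_countable_right fun x => measurable_prefixValue x
    exact h.comp (measurable_fst.prodMk ((hT.comp hSm).prodMk (hQ.comp hSm)))
  have hmeanm : Measurable mean :=
    Measurable.indicator ((measurable_queryMean P).comp (hQ.comp hSm)) (hSm hDm)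
  have hpv0 (w) : 0 ≤ pv w := Set.indicator_nonneg (fun w _ => prefixValue_nonneg _ _ _) w
  have hmean0 (w) : 0 ≤ mean w := Set.indicator_nonneg (fun w _ => queryMean_nonneg _ _) w
  have hpvi : Integrable pv J := by
    refine Integrable.of_bound hpvm.aestronglyMeasurable 1 (Filter.Eventually.of_forall fun w => ?_)
    rw [Real.norm_of_nonneg (hpv0 w)]
    refine Set.indicator_le' (fun w hw => ?_) (fun _ _ => zero_le_one) w
    exact prefixValue_le_one (hn₀.trans (hD _ hw).1) (hD _ hw).2 _ _
  have hmean1 (w) : mean w ≤ (S ⁻¹' D).indicator (fun _ => 1) w :=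
    Set.indicator_le_indicator (queryMean_le_one P _)
  have hmeani : Integrable mean J := by
    refine Integrable.of_bound hmeanm.aestronglyMeasurable 1
      (Filter.Eventually.of_forall fun w => ?_)
    rw [Real.norm_of_nonneg (hmean0 w)]
    exact Set.indicator_le' (fun w hw => queryMean_le_one P _) (fun _ _ => zero_le_one) w
  have hDi : Integrable ((S ⁻¹' D).indicator fun _ => (1 : ℝ)) J :=
    (integrable_const _).indicator (hSm hDm)
  have hBi : Integrable ((bad ∩ S ⁻¹' D).indicator fun _ => (1 : ℝ)) J :=
    (integrable_const _).indicator (hbad.inter (hSm hDm))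
  have hDp : ∫ w, (S ⁻¹' D).indicator (fun _ => (1 : ℝ)) w ∂J = J.real (S ⁻¹' D) :=
    integral_indicator_one (hSm hDm)
  have hBp : ∫ w, (bad ∩ S ⁻¹' D).indicator (fun _ => (1 : ℝ)) w ∂J
      = J.real (bad ∩ S ⁻¹' D) :=
    integral_indicator_one (hbad.inter (hSm hDm))
  have hgen : ∫ w, pv w ∂J ≤ Real.exp ε * ∫ w, mean w ∂J + n * deltaOf ρ ε / n₀ := by
    have h := lintegral_selected_le (A := A) hn₀ hσ hρ P μ hDm hT hQ hD ε N hs₀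
    have e1 : ∫⁻ w, D.indicator (fun s => ENNReal.ofReal (prefixValue (Q s) (T s) w.1))
        (flatRun sigma ρ A w.1 w.2.1 w.2.2 N s₀) ∂J = ENNReal.ofReal (∫ w, pv w ∂J) := by
      rw [ofReal_integral_eq_lintegral_ofReal hpvi (Filter.Eventually.of_forall hpv0)]
      refine lintegral_congr fun w => ?_
      rw [hpv, hS]
      by_cases hw : flatRun sigma ρ A w.1 w.2.1 w.2.2 N s₀ ∈ D <;> simp [Set.indicator, hw]
    have e2 : ∫⁻ w, D.indicator (fun s => ENNReal.ofReal (queryMean P (Q s)))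
        (flatRun sigma ρ A w.1 w.2.1 w.2.2 N s₀) ∂J = ENNReal.ofReal (∫ w, mean w ∂J) := by
      rw [ofReal_integral_eq_lintegral_ofReal hmeani (Filter.Eventually.of_forall hmean0)]
      refine lintegral_congr fun w => ?_
      rw [hmean, hS]
      by_cases hw : flatRun sigma ρ A w.1 w.2.1 w.2.2 N s₀ ∈ D <;> simp [Set.indicator, hw]
    have hδ := deltaOf_nonneg ρ ε
    have hm : 0 ≤ ∫ w, mean w ∂J := integral_nonneg hmean0
    rw [e1, e2, ← ENNReal.ofReal_mul (Real.exp_nonneg _),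
      ← ENNReal.ofReal_add (by positivity) (by positivity),
      ENNReal.ofReal_le_ofReal_iff (by positivity)] at h
    exact h
  -- Integrates the pointwise hypotheses; on `bad` the unit of slack in `h2` is paid by the
  -- indicator.
  have hpt : c * J.real (S ⁻¹' D) + ∫ w, mean w ∂J
      ≤ ∫ w, pv w ∂J + J.real (bad ∩ S ⁻¹' D) := by
    rw [← hDp, ← hBp, ← integral_const_mul, ← integral_add (hDi.const_mul c) hmeani,
      ← integral_add hpvi hBi]
    refine integral_mono ((hDi.const_mul c).add hmeani) (hpvi.add hBi) fun w => ?_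
    by_cases hw : S w ∈ D
    · by_cases hb : w ∈ bad
      · simpa [hpv, hmean, Set.indicator, hw, hb] using h2 w hw
      · simpa [hpv, hmean, Set.indicator, hw, hb] using h1 w hw hb
    · simp [hpv, hmean, Set.indicator, hw]
  -- The multiplicative loss `exp ε` costs only `exp ε - 1` times the probability of selection,
  -- because means are at most one.
  have hle : ∫ w, mean w ∂J ≤ J.real (S ⁻¹' D) := by
    rw [← hDp]
    exact integral_mono hmeani hDi hmean1
  have hexp : 0 ≤ Real.exp ε - 1 := by linarith [Real.one_le_exp hε]
  nlinarith [mul_le_mul_of_nonneg_left hle hexp]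

theorem measurableSet_errs (P : Measure X) [IsProbabilityMeasure P] (n₀ n k : ℕ) (α : ℝ) (i : ℕ) :
    MeasurableSet {s : FlatState X | Errs P n₀ n k α s i} := by
  have hent : Measurable fun s : FlatState X => s.entry i :=
    (measurable_pi_apply i).comp FlatState.measurable_entry
  have hm : Measurable fun s : FlatState X => queryMean P (s.entry i).2.1 :=
    (measurable_queryMean P).comp (by fun_prop)
  refine MeasurableSet.inter (MeasurableSet.const _) (MeasurableSet.inter ?_
    (MeasurableSet.inter ?_ (MeasurableSet.inter ?_ ?_)))
  · exact FlatState.measurable_size measurableSet_Ioi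
  · exact hent.fst measurableSet_Ici
  · exact hent.fst measurableSet_Iic
  · exact measurableSet_lt measurable_const (by fun_prop :
      Measurable fun s : FlatState X => |(s.entry i).2.2 - queryMean P (s.entry i).2.1|)

open Classical in
theorem measurable_firstError (P : Measure X) [IsProbabilityMeasure P] (n₀ n k : ℕ) (α : ℝ) :
    Measurable (firstError P n₀ n k α : FlatState X → ℕ) :=
  measurable_find _ fun i => (measurableSet_errs P n₀ n k α i).union (MeasurableSet.const _)

/-- Selecting the first error is post-processing of the state, so a single application of the
transfer bound per sign covers all `k` answers, with no union bound over queries. -/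
theorem measure_exists_errs_le (hn₀ : 1 ≤ n₀) {σ : ℝ} (hσ : 0 < σ) (hρ : 0 ≤ ρ)
    (P : Measure X) [IsProbabilityMeasure P] (μ : Measure Ω) [IsProbabilityMeasure μ]
    {k : ℕ} (hk : 1 ≤ k) {β' β ε : ℝ} (hβ' : 0 < β') (h0 : 0 < β) (h1 : β < 1) (hε : 0 ≤ ε)
    (N : ℕ) (A : Analyst X Ω) :
    jointLaw n P μ {w | ∃ i, Errs P n₀ n k (errorBound n₀ n k ρ β' σ β ε)
        (flatRun (fun _ => σ) ρ A w.1 w.2.1 w.2.2 N (flatten (initState X n₀))) i}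
      ≤ ENNReal.ofReal β' := by
  set α := errorBound n₀ n k ρ β' σ β ε with hα
  set s₀ := flatten (initState X n₀)
  set S : (Fin n → X) × Ω × (ℕ → ℝ) → FlatState X :=
    fun w => flatRun (fun _ => σ) ρ A w.1 w.2.1 w.2.2 N s₀ with hS
  set J := jointLaw n P μ
  set u := erfcInv (β / k) with hu
  set δ := n * deltaOf ρ ε / n₀ with hδ
  have hk0 : (0 : ℝ) < k := by exact_mod_cast hk
  have hk1 : (1 : ℝ) ≤ k := by exact_mod_cast hk
  have hu0 : 0 ≤ u := erfcInv_nonneg (by positivity) (by rw [div_lt_one hk0]; linarith)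
  have hδ0 : 0 ≤ δ := by
    have := deltaOf_nonneg ρ ε
    positivity
  have hexp : 0 ≤ Real.exp ε - 1 := by linarith [Real.one_le_exp hε]
  set α₁ := Real.sqrt 2 * σ * u with hα₁
  have hα₁0 : 0 ≤ α₁ := by positivity
  -- `K` is what `α` leaves after the noise and `exp ε - 1`. The argument needs only `β + 2 * δ ≤ K
  -- * β'`; the square root is slack.
  set K := (β + 2 * δ + 2 * Real.sqrt (2 * β * δ)) / β' with hK
  have hK0 : 0 < K := by positivity
  have hαK : α = α₁ + (Real.exp ε - 1) + K := by
    have e1 : 2 * β * n * deltaOf ρ ε / n₀ = 2 * β * δ := by rw [hδ]; ring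
    have e2 : 2 * n * deltaOf ρ ε / (n₀ * β') = 2 * δ / β' := by
      rw [hδ, mul_div_assoc' 2, div_div]; ring
    rw [hα, errorBound, e1, e2, hK]
    ring
  set I := firstError (X := X) P n₀ n k α with hI
  have hIm : Measurable I := measurable_firstError P n₀ n k α
  set e : FlatState X → Entry X := fun s => s.entry (I s) with he
  have hem : Measurable e := measurable_comp_nat FlatState.measurable_entry hIm
  set C : Set (FlatState X) := {s | Errs P n₀ n k α s (I s)} with hC
  set Dp : Set (FlatState X) := {s | I s < k ∧ I s < s.size ∧ n₀ ≤ (e s).1 ∧ (e s).1 ≤ n ∧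
    α < (e s).2.2 - queryMean P (e s).2.1} with hDp
  set Dm : Set (FlatState X) := {s | I s < k ∧ I s < s.size ∧ n₀ ≤ (e s).1 ∧ (e s).1 ≤ n ∧
    α < queryMean P (e s).2.1 - (e s).2.2} with hDm
  have hqm : Measurable fun s => queryMean P (e s).2.1 :=
    (measurable_queryMean P).comp (by fun_prop)
  have hmeas {g : FlatState X → ℝ} (hg : Measurable g) : MeasurableSet {s : FlatState X |
      I s < k ∧ I s < s.size ∧ n₀ ≤ (e s).1 ∧ (e s).1 ≤ n ∧ α < g s} := by
    refine MeasurableSet.inter (hIm measurableSet_Iio) (MeasurableSet.inter ?_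
      (MeasurableSet.inter (hem.fst measurableSet_Ici) (MeasurableSet.inter
        (hem.fst measurableSet_Iic) (measurableSet_lt measurable_const hg))))
    exact measurableSet_lt hIm FlatState.measurable_size
  have hDpm : MeasurableSet Dp := hmeas (by fun_prop)
  have hDmm : MeasurableSet Dm := hmeas (by fun_prop)
  set bad := largeNoise X Ω n k u with hbad
  have hbadm : MeasurableSet bad := measurableSet_largeNoise k u
  have hSm : Measurable S := measurable_flatRun_joint N s₀
  have hcons (w) : Consistent n₀ (fun _ => σ) w.1 w.2.2 (S w) :=
    flatten_initState_consistent.flatRun ρ A w.2.1 N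
  have hresp (w) (hk : I (S w) < k) (hs : I (S w) < (S w).size) :
      (0 ≤ (e (S w)).2.2 ∧ (e (S w)).2.2 ≤ 1) ∧
      (w ∉ bad → |(e (S w)).2.2 - prefixValue (e (S w)).2.1 (e (S w)).1 w.1| ≤ α₁) := by
    obtain ⟨ht1, ht2, hr⟩ := (hcons w).2 _ hs
    have hr' : (e (S w)).2.2 = _ := hr
    rw [hr']
    refine ⟨clamp_mem _, fun hw => ?_⟩
    refine (abs_clamp_add_sub_le (prefixValue_nonneg _ _ _)
      (prefixValue_le_one (hn₀.trans ht1) ht2 _ _)).trans ?_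
    have hz : |w.2.2 (I (S w))| ≤ Real.sqrt 2 * u := by
      by_contra! hlt
      exact hw (Set.mem_biUnion (Finset.mem_coe.2 (Finset.mem_range.2 hk)) hlt)
    rw [abs_mul, abs_of_pos hσ, hα₁]
    nlinarith
  have hp := measureReal_selected_le (A := A) (S := S) (c := α - α₁) hn₀ (fun _ => hσ) hρ P μ hDpm
    hem.fst hem.snd.fst (fun s hs => ⟨hs.2.2.1, hs.2.2.2.1⟩) hε N (s₀ := s₀) rfl hbadm hS
    (fun w hw hb => by
      have h := (abs_le.1 ((hresp w hw.1 hw.2.1).2 hb)).2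
      linarith [hw.2.2.2.2])
    (fun w hw => by
      have h := (hresp w hw.1 hw.2.1).1.2
      have h' := prefixValue_nonneg (e (S w)).2.1 (e (S w)).1 w.1
      linarith [hw.2.2.2.2])
  -- An answer that is too low for `q` is too high for `1 - q`. In the bad event, clipping supplies
  -- the bound with unit slack, as it does for the other sign.
  have hm := measureReal_selected_le (A := A) (S := S) (c := α - α₁)
    (Q := fun s v => unitInterval.symm ((e s).2.1 v)) hn₀ (fun _ => hσ) hρ P μ hDmm
    hem.fst (measurable_pi_lambda _ fun v => unitInterval.continuous_symm.measurable.comp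
      ((measurable_pi_apply v).comp hem.snd.fst))
    (fun s hs => ⟨hs.2.2.1, hs.2.2.2.1⟩) hε N (s₀ := s₀) rfl hbadm hS
    (fun w hw hb => by
      have h := (abs_le.1 ((hresp w hw.1 hw.2.1).2 hb)).1
      rw [prefixValue_symm (hn₀.trans hw.2.2.1) hw.2.2.2.1, queryMean_symm]
      linarith [hw.2.2.2.2])
    (fun w hw => by
      have h := (hresp w hw.1 hw.2.1).1.1
      have h' := prefixValue_le_one (hn₀.trans hw.2.2.1) hw.2.2.2.1 (e (S w)).2.1 w.1
      rw [prefixValue_symm (hn₀.trans hw.2.2.1) hw.2.2.2.1, queryMean_symm]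
      linarith [hw.2.2.2.2])
  have hdisj : Disjoint (S ⁻¹' Dp) (S ⁻¹' Dm) := by
    refine Set.disjoint_left.2 fun w h2 h3 => ?_
    have h4 := h2.2.2.2.2
    have h5 := h3.2.2.2.2
    linarith
  -- The two signs exclude each other, so the noise probability `β` is spent once, whereas `δ` is
  -- spent twice.
  have hbadsum : J.real (bad ∩ S ⁻¹' Dp) + J.real (bad ∩ S ⁻¹' Dm) ≤ β := by
    rw [← measureReal_union (hdisj.mono Set.inter_subset_right Set.inter_subset_right)
      (hbadm.inter (hSm hDmm))]
    calc _ ≤ J.real bad := measureReal_mono (Set.union_subset Set.inter_subset_left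
          Set.inter_subset_left)
      _ ≤ β := ENNReal.toReal_le_of_le_ofReal h0.le (measure_largeNoise_le P μ hk h0 h1)
  have hcK : α - α₁ - (Real.exp ε - 1) = K := by rw [hαK]; ring
  rw [hcK] at hp hm
  have htotal : J.real (S ⁻¹' Dp) + J.real (S ⁻¹' Dm) ≤ β' := by
    have h3 : K * (J.real (S ⁻¹' Dp) + J.real (S ⁻¹' Dm)) ≤ K * β' := by
      rw [hK, div_mul_cancel₀ _ hβ'.ne', ← hK]
      have := Real.sqrt_nonneg (2 * β * δ)
      linarith
    exact le_of_mul_le_mul_left h3 hK0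
  have hsub : {w | ∃ i, Errs P n₀ n k α (S w) i} ⊆ S ⁻¹' Dp ∪ S ⁻¹' Dm := by
    intro w hw
    obtain ⟨a1, a2, a3, a4, a5⟩ := errs_firstError hw
    rcases lt_abs.1 a5 with h | h
    · exact Or.inl ⟨a1, a2, a3, a4, h⟩
    · exact Or.inr ⟨a1, a2, a3, a4, by rwa [neg_sub] at h⟩
  calc _ ≤ J (S ⁻¹' Dp ∪ S ⁻¹' Dm) := measure_mono hsub
    _ = ENNReal.ofReal (J.real (S ⁻¹' Dp ∪ S ⁻¹' Dm)) := (ofReal_measureReal).symm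
    _ ≤ ENNReal.ofReal β' :=
      ENNReal.ofReal_le_ofReal ((measureReal_union_le _ _).trans htotal)

end Accuracy

/-! ### Unbounded interactions and the infimum over the free parameters. -/

section Main

/-- A released entry is never overwritten, since updates happen at index `size`. Hence the error
events increase with the number of steps. -/
theorem Errs.flatStep {X Ω : Type*} [MeasurableSpace X] [MeasurableSpace Ω] {P : Measure X}
    {n₀ n k : ℕ} {α : ℝ} {s : FlatState X} {i : ℕ} (h : Errs P n₀ n k α s i) (sigma : ℕ → ℝ)
    (ρ : ℝ) (A : Analyst X Ω) (x : Fin n → X) (ω : Ω) (z : ℕ → ℝ) :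
    Errs P n₀ n k α (flatStep sigma ρ A x ω z s) i := by
  obtain ⟨h1, h2, h3⟩ := h
  have he : (GrowingADA.flatStep sigma ρ A x ω z s).entry i = s.entry i := by
    by_cases ha : Answers n sigma ρ A ω s
    · rw [flatStep_of_answers ha]
      exact Function.update_of_ne h2.ne _ _
    · rw [flatStep_of_not_answers ha, idle_entry]
  refine ⟨h1, h2.trans_le (size_le_flatStep_size sigma ρ A x ω z s), ?_⟩
  rwa [he]

/-- The bound for `N` steps does not depend on `N`, so continuity from below extends it to the whole
interaction. -/
theorem isDistributionallyAccurate_errorBound (X : Type u) [Finite X] [MeasurableSpace X]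
    [MeasurableSingletonClass X] {n₀ n k : ℕ} (hn₀ : 1 ≤ n₀) (hk : 1 ≤ k) {β' σ ρ β ε : ℝ}
    (hβ' : 0 < β') (hσ : 0 < σ) (hρ : 0 ≤ ρ) (h0 : 0 < β) (h1 : β < 1) (hε : 0 ≤ ε) :
    IsDistributionallyAccurate.{u, v} X n₀ n k (fun _ => σ) ρ (errorBound n₀ n k ρ β' σ β ε)
      β' := by
  intro P _ Ω _ μ _ A
  set α := errorBound n₀ n k ρ β' σ β ε with hα
  set E : ℕ → Set ((Fin n → X) × Ω × (ℕ → ℝ)) := fun N => {w | ∃ i, Errs P n₀ n k α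
    (flatRun (fun _ => σ) ρ A w.1 w.2.1 w.2.2 N (flatten (initState X n₀))) i} with hE
  have hmono : Monotone E := by
    refine monotone_nat_of_le_succ fun N w hw => ?_
    obtain ⟨i, hi⟩ := hw
    refine ⟨i, ?_⟩
    have := hi.flatStep (fun _ => σ) ρ A w.1 w.2.1 w.2.2
    rwa [flatRun, ← Function.iterate_succ_apply' (GrowingADA.flatStep (fun _ => σ) ρ A w.1 w.2.1 w.2.2)]
      at this
  calc _ ≤ jointLaw n P μ (⋃ N, E N) := by
        refine measure_mono fun w hw => ?_
        obtain ⟨N, i, hik, hi⟩ := hw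
        refine Set.mem_iUnion.2 ⟨N, i, ?_⟩
        have hc : Consistent n₀ (fun _ => σ) w.1 w.2.2 _ :=
          flatten_initState_consistent.flatRun ρ A w.2.1 N
        rw [← flatten_stateAfter] at hc ⊢
        obtain ⟨c1, c2, -⟩ := hc.2 i i.2
        rw [populationValue_eq_queryMean P (by
          rw [← flatten_entry]; exact hn₀.trans c1), ← flatten_entry] at hi
        exact ⟨hik, i.2, c1, c2, hi⟩
    _ = ⨆ N, jointLaw n P μ (E N) := hmono.measure_iUnion
    _ ≤ ENNReal.ofReal β' := iSup_le fun N =>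
        measure_exists_errs_le hn₀ hσ hρ P μ hk hβ' h0 h1 hε N A

/-- Distributional accuracy passes to the infimum of the error levels. -/
theorem isDistributionallyAccurate_sInf (X : Type u) [MeasurableSpace X] {n₀ n k : ℕ}
    {sigma : ℕ → ℝ} {ρ β' : ℝ} {s : Set ℝ} (hs : s.Nonempty)
    (h : ∀ α ∈ s, IsDistributionallyAccurate.{u, v} X n₀ n k sigma ρ α β') :
    IsDistributionallyAccurate.{u, v} X n₀ n k sigma ρ (sInf s) β' := by
  intro P _ Ω _ μ _ A
  set F : ℝ → Set ((Fin n → X) × Ω × (ℕ → ℝ)) := fun α =>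
    {w | ∃ N, ∃ i : Fin (stateAfter n₀ sigma ρ A w.1 w.2.1 w.2.2 N).size, (i : ℕ) < k ∧
        α < |((stateAfter n₀ sigma ρ A w.1 w.2.1 w.2.2 N).transcript i).2.2 -
          populationValue P
            ((stateAfter n₀ sigma ρ A w.1 w.2.1 w.2.2 N).transcript i).1
            ((stateAfter n₀ sigma ρ A w.1 w.2.1 w.2.2 N).transcript i).2.1|} with hF
  have hanti {a b : ℝ} (hab : a ≤ b) : F b ⊆ F a := by
    rintro w ⟨N, i, hik, hi⟩
    exact ⟨N, i, hik, hab.trans_lt hi⟩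
  -- An error strictly above the infimum exceeds it by some `1 / (m + 1)`, so the event is an
  -- increasing union of events at levels above the infimum.
  have hmono : Monotone fun m : ℕ => F (sInf s + 1 / ((m : ℝ) + 1)) := by
    intro a b hab
    exact hanti (by gcongr)
  calc _ ≤ jointLaw n P μ (⋃ m : ℕ, F (sInf s + 1 / ((m : ℝ) + 1))) := by
        refine measure_mono ?_
        rintro w ⟨N, i, hik, hi⟩
        obtain ⟨m, hm⟩ := exists_nat_one_div_lt (sub_pos.2 hi)
        exact Set.mem_iUnion.2 ⟨m, N, i, hik, by linarith⟩
    _ = ⨆ m : ℕ, jointLaw n P μ (F (sInf s + 1 / ((m : ℝ) + 1))) := hmono.measure_iUnion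
    _ ≤ ENNReal.ofReal β' := by
        refine iSup_le fun m => ?_
        obtain ⟨α, hα, hlt⟩ := exists_lt_of_csInf_lt hs
          (lt_add_of_pos_right (sInf s) (Nat.one_div_pos_of_nat (n := m) : 0 < 1 / ((m : ℝ) + 1)))
        exact (measure_mono (hanti hlt.le)).trans (h α hα P Ω μ A)

end Main

end GrowingADA

end

theorem mainTheorem12 (X : Type u) [Finite X] [MeasurableSpace X]
    [MeasurableSingletonClass X] (n₀ n k : ℕ) (hn₀ : 1 ≤ n₀) (hn : n₀ ≤ n) (hk : 1 ≤ k)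
    (β' : ℝ) (hβ'0 : 0 < β') (hβ'1 : β' < 1) (ρ : ℝ → ℝ) (hρ : ∀ σ, 0 < σ → 0 ≤ ρ σ) :
    (∀ σ : ℝ, 0 < σ →
      GrowingADA.IsDistributionallyAccurate.{u, v} X n₀ n k (fun _ => σ) (ρ σ)
        (sInf {a | ∃ β ε : ℝ, (σ, β, ε) ∈ GrowingADA.paramSet ∧
          a = GrowingADA.errorBound n₀ n k (ρ σ) β' σ β ε}) β') ∧
    (∀ σ β ε : ℝ, (σ, β, ε) ∈ GrowingADA.paramSet →
      IsMinOn (fun θ : ℝ × ℝ × ℝ =>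
        GrowingADA.errorBound n₀ n k (ρ θ.1) β' θ.1 θ.2.1 θ.2.2) GrowingADA.paramSet (σ, β, ε) →
      GrowingADA.IsDistributionallyAccurate.{u, v} X n₀ n k (fun _ => σ) (ρ σ)
        (GrowingADA.errorBound n₀ n k (ρ σ) β' σ β ε) β') := by
  refine ⟨fun σ hσ => GrowingADA.isDistributionallyAccurate_sInf X ?_ ?_, fun σ β ε hθ _ => ?_⟩
  -- Any admissible pair will do: it only shows that the infimum is over a nonempty set.
  · exact ⟨_, 1 / 2, 0, ⟨hσ, by norm_num, by norm_num, le_rfl⟩, rfl⟩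
  · rintro _ ⟨β, ε, ⟨-, h0, h1, hε⟩, rfl⟩
    exact GrowingADA.isDistributionallyAccurate_errorBound X hn₀ hk hβ'0 hσ (hρ σ hσ) h0 h1 hε
  · obtain ⟨hσ, h0, h1, hε⟩ := hθ
    exact GrowingADA.isDistributionallyAccurate_errorBound X hn₀ hk hβ'0 hσ (hρ σ hσ) h0 h1 hε
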